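/- Let $n\ge 1$, $\nu\ge 0$, $\beta>0$, $L>0$ and $\ell\ge 0$. There is a constant $C$, depending only on $(n,\nu,\beta,L,\ell)$, such that the following holds. Let $\mathcal X\subseteq\mathbb R^n$ be a closed convex set with non-empty interior, and let $R:\operatorname{int}(\mathcal X)\to\mathbb R$ be a $\nu$-self-concordant barrier for $\mathcal X$: $R$ is convex and $C^3$, $R(x)\to\infty$ as $x\to\partial\mathcal X$, and for all $x\in\operatorname{int}(\mathcal X)$, $h\in\mathbb R^n$, $$|\nabla^3R(x)[h,h,h]|\le 2\,(h^\top\nabla^2R(x)h)^{3/2},\qquad |\nabla R(x)^\top h|\le\sqrt{\nu}\,(h^\top\nabla^2R(x)h)^{1/2}.$$ Let $T\ge1$ and let $f_1,\dots,f_T:\mathcal X\to\mathbb R$ be fixed in advance, each being $\beta$-strongly concave and Lipschitz continuous on $\mathcal X$, with $|f_t|\le L$ on $\mathcal X$, and differentiable in $\operatorname{int}(\mathcal X)$ with $\ell$-Lipschitz gradient. Put $\eta_t=\frac{1}{2nL\sqrt T}$ and let $z^1,z^2,\dots$ be independent and uniformly distributed on the unit sphere of $\mathbb R^n$. Run the following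 algorithm (eager self-concordant barrier bandit learning): $x^1=\operatorname{argmin}_{\operatorname{int}(\mathcal X)}R$ and, for $t=1,2,\dots$, $$A^t=(\nabla^2R(x^t)+\eta_t\beta(t+1)I_n)^{-1/2},\qquad \hat x^t=x^t+A^tz^t,\qquad \hat v^t=n f_t(\hat x^t)(A^t)^{-1}z^t,$$ $$x^{t+1}=\operatorname*{argmin}_{x'\in\operatorname{int}(\mathcal X)}\Big\{\eta_t\langle\hat v^t,x^t-x'\rangle+\tfrac{\eta_t\beta(t+1)}2\|x^t-x'\|^2+D_R(x',x^t)\Big\},$$ where $D_R(x',x)=R(x')-R(x)-\langle\nabla R(x),x'-x\rangle$ and $\hat x^t$ is the point played in round $t$. Then, for $t=1,\dots,T$, $x^t\in\operatorname{int}(\mathcal X)$, $\hat x^t\in\mathcal X$, and $f_t(x^t)$ and $f_t(\hat x^t)$ are integrable. Moreover the expected regret is $\tilde O(\sqrt T)$, both for the played points and for the pivots: for $y^t=\hat x^t$ as well as for $y^t=x^t$ the maximum below is attained and $$\max_{p\in\mathcal X}\Big\{\sum_{t=1}^Tf_t(p)-\mathbb E\Big[\sum_{t=1}^Tf_t(y^t)\Big]\Big\}\le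 C\sqrt T\,(1+\log T).$$ -/

import Mathlib

open MeasureTheory ProbabilityTheory Filter Topology Set
open scoped NNReal Gradient

noncomputable section

namespace EagerBandit

/-- The Euclidean space `ℝⁿ`. -/
abbrev Eucl (n : ℕ) : Type := EuclideanSpace ℝ (Fin n)

/-- The Hessian `∇²R(x)`, as a linear operator: the derivative of the gradient field. -/
def hess {n : ℕ} (R : Eucl n → ℝ) (x : Eucl n) : Eucl n →L[ℝ] Eucl n :=
  fderiv ℝ (∇ R) x

/-- The Hessian `∇²R(x)` as a matrix in the standard basis. -/
def hessMatrix {n : ℕ} (R : Eucl n → ℝ) (x : Eucl n) : Matrix (Fin n) (Fin n) ℝ :=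
  (Matrix.toEuclideanCLM (n := Fin n) (𝕜 := ℝ)).symm (hess R x)

/-- `R` is a `ν`-self-concordant barrier for `X`. Only the values of `R` on the interior of `X`
matter. Convexity is part of the notion: it makes the powers of `hᵀ ∇²R(x) h` meaningful. -/
structure IsSelfConcordantBarrier {n : ℕ} (ν : ℝ) (X : Set (Eucl n)) (R : Eucl n → ℝ) : Prop where
  convexOn : ConvexOn ℝ (interior X) R
  contDiffOn : ContDiffOn ℝ 3 R (interior X)
  tendsto_boundary : ∀ y ∈ frontier X, Tendsto R (𝓝[interior X] y) atTop
  third_le : ∀ x ∈ interior X, ∀ h : Eucl n,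
    |iteratedFDeriv ℝ 3 R x (fun _ => h)| ≤ 2 * (inner ℝ h (hess R x h)) ^ (3 / 2 : ℝ)
  first_le : ∀ x ∈ interior X, ∀ h : Eucl n,
    |inner ℝ (∇ R x) h| ≤ √ν * √(inner ℝ h (hess R x h))

/-- A minimizer of `g` over `S` (if there is one). -/
def argmin {n : ℕ} (S : Set (Eucl n)) (g : Eucl n → ℝ) : Eucl n :=
  Classical.epsilon fun y => y ∈ S ∧ IsMinOn g S y

/-- The Bregman divergence `D_R(x', x) = R(x') - R(x) - ⟨∇R(x), x' - x⟩`. -/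
def bregman {n : ℕ} (R : Eucl n → ℝ) (x' x : Eucl n) : ℝ :=
  R x' - R x - inner ℝ (∇ R x) (x' - x)

/-- The prox-mapping of round `t` for the mixed Bregman divergence. The barrier is `+∞` on the
boundary of `X`, so the minimum over `X` is the one over the interior. -/
def prox {n : ℕ} (X : Set (Eucl n)) (R : Eucl n → ℝ) (β : ℝ) (t : ℕ)
    (x v : Eucl n) (η : ℝ) : Eucl n :=
  argmin (interior X) fun x' =>
    η * inner ℝ v (x - x') + η * β * ((t : ℝ) + 1) / 2 * ‖x - x'‖ ^ 2 + bregman R x' x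

/-- The scaling matrix `(∇²R(x) + η β (t + 1) I)^{-1/2}` of round `t` at the pivot `x`; the power
is taken by the functional calculus of symmetric matrices. -/
def scaling {n : ℕ} (R : Eucl n → ℝ) (β : ℝ) (t : ℕ) (x : Eucl n) (η : ℝ) :
    Matrix (Fin n) (Fin n) ℝ :=
  cfc (fun r : ℝ => (√r)⁻¹) (hessMatrix R x + (η * β * ((t : ℝ) + 1)) • 1)

/-- The point `x + A z` that is played from the pivot `x` in round `t` with direction `z`. -/
def play {n : ℕ} (R : Eucl n → ℝ) (β : ℝ) (t : ℕ) (x z : Eucl n) (η : ℝ) : Eucl n :=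
  x + Matrix.toEuclideanCLM (𝕜 := ℝ) (scaling R β t x η) z

/-- The single-shot ellipsoidal estimator `n f(x + A z) A⁻¹ z`. -/
def gradEst {n : ℕ} (R : Eucl n → ℝ) (β : ℝ) (t : ℕ) (f : Eucl n → ℝ) (x z : Eucl n) (η : ℝ) :
    Eucl n :=
  ((n : ℝ) * f (play R β t x z η)) • Matrix.toEuclideanCLM (𝕜 := ℝ) (scaling R β t x η)⁻¹ z

/-- The pivots `x¹, x², …` of the algorithm along a sequence `z¹, z², …` of directions.
Rounds are numbered from `1`; the value at `0` is a dummy. -/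
def pivot {n : ℕ} (X : Set (Eucl n)) (R : Eucl n → ℝ) (β : ℝ) (η : ℕ → ℝ)
    (f : ℕ → Eucl n → ℝ) (z : ℕ → Eucl n) : ℕ → Eucl n
  | 0 => argmin (interior X) R
  | 1 => argmin (interior X) R
  | t + 2 =>
    prox X R β (t + 1) (pivot X R β η f z (t + 1))
      (gradEst R β (t + 1) (f (t + 1)) (pivot X R β η f z (t + 1)) (z (t + 1)) (η (t + 1)))
      (η (t + 1))

/-- The actions `x̂¹, x̂², …` that the algorithm plays. -/
def action {n : ℕ} (X : Set (Eucl n)) (R : Eucl n → ℝ) (β : ℝ) (η : ℕ → ℝ)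
    (f : ℕ → Eucl n → ℝ) (z : ℕ → Eucl n) (t : ℕ) : Eucl n :=
  play R β t (pivot X R β η f z t) (z t) (η t)

/-- The uniform probability measure on the unit sphere of `ℝⁿ` (for `n ≥ 1`). -/
def sphereUniform (n : ℕ) : Measure (Metric.sphere (0 : Eucl n) 1) :=
  ((volume : Measure (Eucl n)).toSphere univ)⁻¹ • (volume : Measure (Eucl n)).toSphere

/-- `r = max_{p ∈ X} {∑_{t=1}^T f_t(p) - E[∑_{t=1}^T f_t(y^t)]}`: the maximum is attained and
equals `r`. -/
def IsRegret {n : ℕ} {Ω : Type*} [MeasurableSpace Ω] (P : Measure Ω) (X : Set (Eucl n))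
    (T : ℕ) (f : ℕ → Eucl n → ℝ) (y : ℕ → Ω → Eucl n) (r : ℝ) : Prop :=
  IsGreatest ((fun p => ∑ t ∈ Finset.Icc 1 T, f t p
    - ∫ ω, ∑ t ∈ Finset.Icc 1 T, f t (y t ω) ∂P) '' X) r

/-- The rewards that the adversary may choose: on `X`, `f` is `β`-strongly concave, Lipschitz and
bounded by `L`, and it is differentiable with `ℓ`-Lipschitz gradient in the interior. -/
structure IsReward {n : ℕ} (X : Set (Eucl n)) (β L : ℝ) (ℓ : ℝ≥0) (f : Eucl n → ℝ) : Prop where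
  strongConcaveOn : StrongConcaveOn X β f
  differentiableOn : DifferentiableOn ℝ f (interior X)
  smooth : LipschitzOnWith ℓ (∇ f) (interior X)
  lipschitz : ∃ G : ℝ≥0, LipschitzOnWith G f X
  bounded : ∀ x ∈ X, |f x| ≤ L

end EagerBandit

end

noncomputable section

namespace EagerBandit

section

/-! ### Self-concordance in one variable -/

/-! The algorithm is mirror descent for the regularizer `R` plus a quadratic whose weight c_t =
ηβ(t+1) grows with t, fed with a one-point gradient estimate. Write e for the constant value of `η`.
Four facts carry the proof.

Feasibility and bias. The ellipsoid x + A(ball) lies in the open Dikin ellipsoid of `R`, hence in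
the interior of X (`add_mem_interior`, `play_mem_interior`). By the divergence theorem on the ball
(`integral_sphere_mul_inner`), the estimator has as its conditional mean the gradient of f averaged
over this ellipsoid. Since ‖Aw‖² ≤ 1/c_t, strong concavity and smoothness show that its pairing with
p - x is at least f(p) - f(x) + β/2‖p - x‖² - ℓ/c_t (`le_integral_inner_gradEst`). Moving from the
pivot to the played point costs another ℓ/c_t at most (`le_integral_play`). The sum of ℓ/c_t is of
order log T / e.

Stability. In the local norm a of x' - x for ∇²R(x) + c_t I, the estimator contributes at most
e·nL·a, while self-concordance bounds the mixed Bregman divergence below by a - log(1 + a)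
(`sub_log_le_bregman`). With b = e·nL ≤ 1/2, the gain b·a - (a - log(1 + a)) is at most 2b²
(`mul_sub_sub_log_le`), whatever the length of the step. As b = 1/(2√T), these errors sum to 1/2.

Telescoping. The term β/2‖p - x‖² from strong concavity turns the weight c_t into c_{t-1}, so the
quadratic terms telescope along with the divergences of `R`, leaving only the initial ones
(`sum_mirror_le`).

Comparators. The initial divergence R(p) - R(x¹) may blow up as p approaches the boundary. Pulling p
towards x¹ by the fraction 1/T costs 2L in total reward, and the barrier inequality bounds `R` at
the new point by R(x¹) + (ν+1) log T (`sub_le_log`). Division by e produces the factor √T.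

A bounded strongly concave reward forces X to be compact, so the minimizers and the best comparator
exist. The pivots are continuous functions of the directions, which range over a compact product of
spheres; this settles measurability and integrability, and independence then allows conditioning on
the past. -/

theorem monotoneOn_of_hasDerivAt_nonneg {u u' : ℝ → ℝ} {a b : ℝ}
    (hu : ∀ s ∈ Icc a b, HasDerivAt u (u' s) s) (h0 : ∀ s ∈ Icc a b, 0 ≤ u' s) :
    MonotoneOn u (Icc a b) := by
  refine monotoneOn_of_deriv_nonneg (convex_Icc a b)
    (fun s hs => (hu s hs).continuousAt.continuousWithinAt)
    (fun s hs => (hu s (interior_subset hs)).differentiableAt.differentiableWithinAt)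
    (fun s hs => ?_)
  rw [(hu s (interior_subset hs)).deriv]
  exact h0 s (interior_subset hs)

/-- The derivative of q^(-1/2) is -q'/(2q^(3/2)), so the hypothesis makes q^(-1/2) 1-Lipschitz. The
two bounds on q that follow are rearrangements of this. -/
theorem abs_inv_sqrt_sub_le {q q' : ℝ → ℝ} {b : ℝ} (hb : 0 ≤ b)
    (hq : ∀ s ∈ Icc 0 b, HasDerivAt q (q' s) s) (hpos : ∀ s ∈ Icc 0 b, 0 < q s)
    (hq' : ∀ s ∈ Icc 0 b, |q' s| ≤ 2 * (q s * √(q s))) :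
    |(√(q b))⁻¹ - (√(q 0))⁻¹| ≤ b := by
  have hd : ∀ s ∈ Icc 0 b, HasDerivWithinAt (fun s => (√(q s))⁻¹)
      (-(q' s / (2 * √(q s))) / (√(q s)) ^ 2) (Icc 0 b) s := fun s hs =>
    (((hq s hs).sqrt (hpos s hs).ne').inv (Real.sqrt_pos.2 (hpos s hs)).ne').hasDerivWithinAt
  have := (convex_Icc 0 b).norm_image_sub_le_of_norm_hasDerivWithin_le (C := 1) hd ?_
    (left_mem_Icc.2 hb) (right_mem_Icc.2 hb)
  · simpa [abs_of_nonneg hb] using this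
  · intro s hs
    have h1 := hpos s hs
    have h2 := Real.sqrt_pos.2 h1
    rw [Real.norm_eq_abs, abs_div, abs_neg, abs_div, abs_of_pos (by positivity : 0 < 2 * √(q s)),
      Real.sq_sqrt h1.le, abs_of_pos h1, div_div, div_le_one (by positivity)]
    linarith [hq' s hs]

theorem le_of_selfConcordant {q q' : ℝ → ℝ} {b : ℝ} (hb : 0 ≤ b)
    (hq : ∀ s ∈ Icc 0 b, HasDerivAt q (q' s) s) (hpos : ∀ s ∈ Icc 0 b, 0 < q s)
    (hq' : ∀ s ∈ Icc 0 b, |q' s| ≤ 2 * (q s * √(q s))) :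
    (√(q 0) / (1 + b * √(q 0))) ^ 2 ≤ q b := by
  have h := (abs_le.1 (abs_inv_sqrt_sub_le hb hq hpos hq')).2
  have h0 := Real.sqrt_pos.2 (hpos 0 (left_mem_Icc.2 hb))
  have hb' := Real.sqrt_pos.2 (hpos b (right_mem_Icc.2 hb))
  have h1 : √(q 0) / (1 + b * √(q 0)) ≤ √(q b) := by
    have : (√(q b))⁻¹ ≤ (1 + b * √(q 0)) / √(q 0) := by
      rw [add_div, mul_div_cancel_right₀ _ h0.ne', one_div]; linarith
    rw [← inv_div]
    exact inv_le_of_inv_le₀ hb' this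
  calc _ ≤ (√(q b)) ^ 2 := by gcongr
    _ = q b := Real.sq_sqrt (hpos b (right_mem_Icc.2 hb)).le

theorem selfConcordant_le {q q' : ℝ → ℝ} {b : ℝ} (hb : 0 ≤ b)
    (hq : ∀ s ∈ Icc 0 b, HasDerivAt q (q' s) s) (hpos : ∀ s ∈ Icc 0 b, 0 < q s)
    (hq' : ∀ s ∈ Icc 0 b, |q' s| ≤ 2 * (q s * √(q s))) (hlt : b * √(q 0) < 1) :
    q b ≤ (√(q 0) / (1 - b * √(q 0))) ^ 2 := by
  have h := (abs_le.1 (abs_inv_sqrt_sub_le hb hq hpos hq')).1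
  have h0 := Real.sqrt_pos.2 (hpos 0 (left_mem_Icc.2 hb))
  have hb' := Real.sqrt_pos.2 (hpos b (right_mem_Icc.2 hb))
  have h2 : 0 < 1 - b * √(q 0) := by linarith
  have h1 : √(q b) ≤ √(q 0) / (1 - b * √(q 0)) := by
    have : (1 - b * √(q 0)) / √(q 0) ≤ (√(q b))⁻¹ := by
      rw [sub_div, mul_div_cancel_right₀ _ h0.ne', one_div]; linarith
    rw [← inv_div]
    exact le_inv_of_le_inv₀ (by positivity) this
  calc q b = (√(q b)) ^ 2 := (Real.sq_sqrt (hpos b (right_mem_Icc.2 hb)).le).symm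
    _ ≤ _ := by gcongr

/-- Integrate the lower bound on φ'' twice: the first primitive is a - a/(1 + sa), the second sa -
log(1 + sa). -/
theorem sub_log_le_of_selfConcordant {φ φ' q : ℝ → ℝ} {a : ℝ} (ha : 0 ≤ a)
    (hφ : ∀ s ∈ Icc (0 : ℝ) 1, HasDerivAt φ (φ' s) s)
    (hφ' : ∀ s ∈ Icc (0 : ℝ) 1, HasDerivAt φ' (q s) s)
    (hq : ∀ s ∈ Icc (0 : ℝ) 1, (a / (1 + s * a)) ^ 2 ≤ q s) :
    a - Real.log (1 + a) ≤ φ 1 - φ 0 - φ' 0 := by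
  have h1 : ∀ s ∈ Icc (0 : ℝ) 1, a - a / (1 + s * a) ≤ φ' s - φ' 0 := by
    have hm : MonotoneOn (fun s => φ' s + a / (1 + s * a)) (Icc 0 1) := by
      refine monotoneOn_of_hasDerivAt_nonneg (u' := fun s => q s + (0 * (1 + s * a) - a * (1 * a)) /
        (1 + s * a) ^ 2) (fun s hs => ?_) (fun s hs => ?_)
      · have : 0 < 1 + s * a := by have := mul_nonneg hs.1 ha; linarith
        exact (hφ' s hs).add ((hasDerivAt_const s a).div
          (((hasDerivAt_id s).mul_const a).const_add 1) this.ne')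
      · have := hq s hs
        rw [div_pow] at this
        have e : (0 * (1 + s * a) - a * (1 * a)) / (1 + s * a) ^ 2 = - (a ^ 2 / (1 + s * a) ^ 2) := by
          ring
        simp only [e]; linarith
    intro s hs
    have := hm (left_mem_Icc.2 zero_le_one) hs hs.1
    simp only [zero_mul, add_zero, div_one] at this
    linarith
  have hm : MonotoneOn (fun s => φ s - s * φ' 0 - (s * a - Real.log (1 + s * a))) (Icc 0 1) := by
    refine monotoneOn_of_hasDerivAt_nonneg
      (u' := fun s => φ' s - 1 * φ' 0 - (1 * a - 1 * a / (1 + s * a))) (fun s hs => ?_)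
      (fun s hs => ?_)
    · have : 0 < 1 + s * a := by have := mul_nonneg hs.1 ha; linarith
      exact ((hφ s hs).sub ((hasDerivAt_id s).mul_const _)).sub (((hasDerivAt_id s).mul_const a).sub
        ((((hasDerivAt_id s).mul_const a).const_add 1).log this.ne'))
    · have := h1 s hs
      simp only [one_mul]; linarith
  have := hm (left_mem_Icc.2 zero_le_one) (right_mem_Icc.2 zero_le_one) zero_le_one
  simp at this
  linarith

/-- If `φ'' ≤ M` on `[0, b)` with `b ≤ 1`, then `φ` is bounded above there. -/
theorem le_of_snd_deriv_le {φ φ' q : ℝ → ℝ} {b M : ℝ} (hM : 0 ≤ M) (hb : 0 ≤ b) (hb1 : b ≤ 1)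
    (hφ : ∀ s ∈ Icc 0 b, HasDerivAt φ (φ' s) s) (hφ' : ∀ s ∈ Icc 0 b, HasDerivAt φ' (q s) s)
    (hq : ∀ s ∈ Icc 0 b, q s ≤ M) : φ b ≤ φ 0 + |φ' 0| + M := by
  have h1 : ∀ s ∈ Icc 0 b, φ' s ≤ φ' 0 + M := by
    have hm : MonotoneOn (fun s => s * M - φ' s) (Icc 0 b) :=
      monotoneOn_of_hasDerivAt_nonneg (fun s hs => ((hasDerivAt_id s).mul_const M).sub (hφ' s hs))
        (fun s hs => by have := hq s hs; linarith)
    intro s hs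
    have := hm (left_mem_Icc.2 hb) hs hs.1
    simp only [zero_mul] at this
    nlinarith [hs.1, hs.2]
  have hm : MonotoneOn (fun s => s * (φ' 0 + M) - φ s) (Icc 0 b) :=
    monotoneOn_of_hasDerivAt_nonneg (fun s hs => ((hasDerivAt_id s).mul_const _).sub (hφ s hs))
      (fun s hs => by have := h1 s hs; linarith)
  have := hm (left_mem_Icc.2 hb) (right_mem_Icc.2 hb) hb
  simp only [zero_mul] at this
  nlinarith [le_abs_self (φ' 0), abs_nonneg (φ' 0)]

/-- Where φ' > 0, the inequality φ'² ≤ νφ'' makes -1/φ' - s/ν nondecreasing. A positive slope at s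
would therefore become infinite before s + ν/φ'(s), so this point cannot precede 1, that is, φ'(s) ≤
ν/(1 - s). Integration gives the logarithm. -/
theorem sub_le_log_of_barrier {φ φ' q : ℝ → ℝ} {ν : ℝ} (hν : 0 < ν)
    (hφ : ∀ s ∈ Ico (0 : ℝ) 1, HasDerivAt φ (φ' s) s)
    (hφ' : ∀ s ∈ Ico (0 : ℝ) 1, HasDerivAt φ' (q s) s)
    (hq0 : ∀ s ∈ Ico (0 : ℝ) 1, 0 ≤ q s)
    (hq : ∀ s ∈ Ico (0 : ℝ) 1, φ' s ^ 2 ≤ ν * q s) {b : ℝ} (hb : b ∈ Ico (0 : ℝ) 1) :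
    φ b - φ 0 ≤ ν * Real.log (1 / (1 - b)) := by
  have key : ∀ s ∈ Ico (0 : ℝ) 1, φ' s * (1 - s) ≤ ν := by
    intro s hs
    by_cases hneg : φ' s ≤ 0
    · nlinarith [hs.2]
    push Not at hneg
    have step : ∀ r ∈ Ico s 1, φ' s * (r - s) ≤ ν := by
      intro r hr
      have hsub : ∀ y ∈ Icc s r, y ∈ Ico (0 : ℝ) 1 := fun y hy =>
        ⟨hs.1.trans hy.1, hy.2.trans_lt hr.2⟩
      have hmono : MonotoneOn φ' (Icc s r) :=
        monotoneOn_of_hasDerivAt_nonneg (fun y hy => hφ' y (hsub y hy)) fun y hy => hq0 y (hsub y hy)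
      have hpos : ∀ y ∈ Icc s r, 0 < φ' y := fun y hy =>
        hneg.trans_le (hmono (left_mem_Icc.2 hr.1) hy hy.1)
      have hm : MonotoneOn (fun y => -(φ' y)⁻¹ - y / ν) (Icc s r) := by
        refine monotoneOn_of_hasDerivAt_nonneg (fun y hy =>
          ((hφ' y (hsub y hy)).inv (hpos y hy).ne').neg.sub ((hasDerivAt_id y).div_const ν)) ?_
        intro y hy
        have h1 := hpos y hy
        have h2 := hq y (hsub y hy)
        have : 1 / ν ≤ q y / φ' y ^ 2 := by
          rw [div_le_div_iff₀ hν (by positivity)]; linarith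
        rw [neg_div, neg_neg]; linarith
      have h1 := hm (left_mem_Icc.2 hr.1) (right_mem_Icc.2 hr.1) hr.1
      have h2 : 0 < (φ' r)⁻¹ := inv_pos.2 (hpos r (right_mem_Icc.2 hr.1))
      have h3 : (r - s) / ν ≤ (φ' s)⁻¹ := by
        rw [sub_div]; simp only at h1; linarith
      rw [div_le_iff₀ hν, inv_mul_eq_div, le_div_iff₀ hneg] at h3
      linarith
    by_contra! hc
    have hlt : ν / φ' s < 1 - s := by rw [div_lt_iff₀ hneg]; linarith
    have h5 : 0 < ν / φ' s := by positivity
    -- The test point is the midpoint of 1 and s + ν/φ'(s); there φ'(s)(r - s) is the mean of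
    -- φ'(s)(1 - s) and ν, hence exceeds ν.
    have h6 := step ((s + 1) / 2 + (ν / φ' s) / 2) ⟨by linarith [hs.2], by linarith⟩
    have h7 : φ' s * ((s + 1) / 2 + (ν / φ' s) / 2 - s) = φ' s * (1 - s) / 2 + ν / 2 := by
      field_simp; ring
    linarith
  have hm : MonotoneOn (fun s => -(ν * Real.log (1 - s)) - φ s) (Icc 0 b) := by
    have hsub : ∀ y ∈ Icc 0 b, y ∈ Ico (0 : ℝ) 1 := fun y hy => ⟨hy.1, hy.2.trans_lt hb.2⟩
    refine monotoneOn_of_hasDerivAt_nonneg (fun y hy =>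
      (((((hasDerivAt_id y).const_sub 1).log (by have := (hsub y hy).2; simp; linarith)).const_mul
        ν).neg.sub (hφ y (hsub y hy)))) ?_
    intro y hy
    have h1 := key y (hsub y hy)
    have h2 : 0 < 1 - y := by linarith [(hsub y hy).2]
    rw [← le_div_iff₀ h2] at h1
    have : -(ν * (-1 / (1 - id y))) = ν / (1 - y) := by simp; ring
    rw [this]; linarith
  have := hm (left_mem_Icc.2 hb.1) (right_mem_Icc.2 hb.1) hb.1
  simp at this
  rw [one_div, Real.log_inv]
  linarith

end

section

variable {n : ℕ} {ν : ℝ} {X : Set (Eucl n)} {R : Eucl n → ℝ}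

/-! ### Derivatives of a barrier -/

namespace IsSelfConcordantBarrier

theorem contDiffAt (hR : IsSelfConcordantBarrier ν X R) {x : Eucl n} (hx : x ∈ interior X) :
    ContDiffAt ℝ 3 R x :=
  hR.contDiffOn.contDiffAt (isOpen_interior.mem_nhds hx)

theorem contDiffOn_fderiv (hR : IsSelfConcordantBarrier ν X R) :
    ContDiffOn ℝ 2 (fderiv ℝ R) (interior X) :=
  hR.contDiffOn.fderiv_of_isOpen isOpen_interior (by norm_num)

theorem contDiffOn_gradient (hR : IsSelfConcordantBarrier ν X R) :
    ContDiffOn ℝ 2 (∇ R) (interior X) :=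
  (InnerProductSpace.toDual ℝ (Eucl n)).symm.toContinuousLinearEquiv.contDiff.comp_contDiffOn
    hR.contDiffOn_fderiv

theorem continuousOn_gradient (hR : IsSelfConcordantBarrier ν X R) :
    ContinuousOn (∇ R) (interior X) :=
  hR.contDiffOn_gradient.continuousOn

theorem contDiffOn_hess (hR : IsSelfConcordantBarrier ν X R) :
    ContDiffOn ℝ 1 (hess R) (interior X) :=
  hR.contDiffOn_gradient.fderiv_of_isOpen isOpen_interior (by norm_num)

theorem continuousOn_hess (hR : IsSelfConcordantBarrier ν X R) :
    ContinuousOn (hess R) (interior X) :=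
  hR.contDiffOn_hess.continuousOn

theorem hasGradientAt (hR : IsSelfConcordantBarrier ν X R) {x : Eucl n} (hx : x ∈ interior X) :
    HasGradientAt R (∇ R x) x :=
  ((hR.contDiffAt hx).differentiableAt (by norm_num)).hasGradientAt

theorem hasFDerivAt_gradient (hR : IsSelfConcordantBarrier ν X R) {x : Eucl n}
    (hx : x ∈ interior X) : HasFDerivAt (∇ R) (hess R x) x :=
  ((hR.contDiffOn_gradient.contDiffAt (isOpen_interior.mem_nhds hx)).differentiableAt
    (by norm_num)).hasFDerivAt

theorem hasFDerivAt_hess (hR : IsSelfConcordantBarrier ν X R) {x : Eucl n}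
    (hx : x ∈ interior X) : HasFDerivAt (hess R) (fderiv ℝ (hess R) x) x :=
  ((hR.contDiffOn_hess.contDiffAt (isOpen_interior.mem_nhds hx)).differentiableAt
    (by norm_num)).hasFDerivAt

/-- The Riesz isomorphism is linear and commutes with differentiation. This links `hess` to the
second Fréchet derivative, whose symmetry is then available. -/
theorem inner_hess_apply (hR : IsSelfConcordantBarrier ν X R) {x : Eucl n}
    (hx : x ∈ interior X) (u v : Eucl n) :
    inner ℝ (hess R x u) v = fderiv ℝ (fderiv ℝ R) x u v := by
  have h1 : HasFDerivAt (fderiv ℝ R) (fderiv ℝ (fderiv ℝ R) x) x :=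
    ((hR.contDiffOn_fderiv.contDiffAt (isOpen_interior.mem_nhds hx)).differentiableAt
      (by norm_num)).hasFDerivAt
  have h2 : HasFDerivAt (∇ R) _ x :=
    ((InnerProductSpace.toDual ℝ (Eucl n)).symm.toContinuousLinearEquiv.hasFDerivAt).comp x h1
  rw [hess, h2.fderiv]
  simp

theorem inner_hess_comm (hR : IsSelfConcordantBarrier ν X R) {x : Eucl n}
    (hx : x ∈ interior X) (u v : Eucl n) :
    inner ℝ (hess R x u) v = inner ℝ u (hess R x v) := by
  rw [real_inner_comm (hess R x v) u, hR.inner_hess_apply hx, hR.inner_hess_apply hx]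
  exact (hR.contDiffAt hx).isSymmSndFDerivAt (by simp; norm_num) u v

/-- Identifies the derivative of the quadratic form of the Hessian along a line with the third
derivative that self-concordance controls. -/
theorem inner_fderiv_hess_apply (hR : IsSelfConcordantBarrier ν X R) {x : Eucl n}
    (hx : x ∈ interior X) (h : Eucl n) :
    inner ℝ h (fderiv ℝ (hess R) x h h) = iteratedFDeriv ℝ 3 R x (fun _ => h) := by
  have e1 : (fun y => iteratedFDeriv ℝ 2 R y (fun _ => h)) =ᶠ[𝓝 x]
      fun y => inner ℝ h (hess R y h) := by
    filter_upwards [isOpen_interior.mem_nhds hx] with y hy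
    rw [iteratedFDeriv_two_apply, ← hR.inner_hess_apply hy, real_inner_comm]
  have h1 : HasFDerivAt (iteratedFDeriv ℝ 2 R) (fderiv ℝ (iteratedFDeriv ℝ 2 R) x) x :=
    ((hR.contDiffAt hx).differentiableAt_iteratedFDeriv (by norm_num)).hasFDerivAt
  have h2 : HasFDerivAt (fun y => iteratedFDeriv ℝ 2 R y (fun _ => h)) _ x :=
    (ContinuousMultilinearMap.apply ℝ (fun _ : Fin 2 => Eucl n) ℝ
      (fun _ => h)).hasFDerivAt.comp x h1
  have h3 : HasFDerivAt (fun y => inner ℝ h (hess R y h)) _ x :=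
    (innerSL ℝ h).hasFDerivAt.comp x
      ((ContinuousLinearMap.apply ℝ (Eucl n) h).hasFDerivAt.comp x (hR.hasFDerivAt_hess hx))
  have h4 := DFunLike.congr_fun (h3.unique (h2.congr_of_eventuallyEq e1.symm)) h
  rw [iteratedFDeriv_succ_apply_left]
  exact h4

section Line

variable {x d : Eucl n} {s : ℝ}

theorem hasDerivAt_line (hR : IsSelfConcordantBarrier ν X R) (hs : x + s • d ∈ interior X) :
    HasDerivAt (fun s : ℝ => R (x + s • d)) (inner ℝ (∇ R (x + s • d)) d) s := by
  have h1 : HasDerivAt (fun s : ℝ => x + s • d) d s := by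
    simpa using ((hasDerivAt_id s).smul_const d).const_add x
  exact (hR.hasGradientAt hs).hasFDerivAt.comp_hasDerivAt s h1

theorem hasDerivAt_line_gradient (hR : IsSelfConcordantBarrier ν X R)
    (hs : x + s • d ∈ interior X) :
    HasDerivAt (fun s : ℝ => inner ℝ (∇ R (x + s • d)) d)
      (inner ℝ d (hess R (x + s • d) d)) s := by
  have h1 : HasDerivAt (fun s : ℝ => x + s • d) d s := by
    simpa using ((hasDerivAt_id s).smul_const d).const_add x
  have := (innerSL ℝ d).hasFDerivAt.comp_hasDerivAt s
    ((hR.hasFDerivAt_gradient hs).comp_hasDerivAt s h1)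
  simpa [real_inner_comm d, Function.comp_def] using this

theorem hasDerivAt_line_hess (hR : IsSelfConcordantBarrier ν X R)
    (hs : x + s • d ∈ interior X) :
    HasDerivAt (fun s : ℝ => inner ℝ d (hess R (x + s • d) d))
      (iteratedFDeriv ℝ 3 R (x + s • d) (fun _ => d)) s := by
  have h1 : HasDerivAt (fun s : ℝ => x + s • d) d s := by
    simpa using ((hasDerivAt_id s).smul_const d).const_add x
  have := (innerSL ℝ d).hasFDerivAt.comp_hasDerivAt s
    ((ContinuousLinearMap.apply ℝ (Eucl n) d).hasFDerivAt.comp_hasDerivAt s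
      ((hR.hasFDerivAt_hess hs).comp_hasDerivAt s h1))
  rw [← hR.inner_fderiv_hess_apply hs]
  simpa [Function.comp_def] using this

end Line

theorem inner_gradient_le (hR : IsSelfConcordantBarrier ν X R) {x y : Eucl n}
    (hx : x ∈ interior X) (hy : y ∈ interior X) :
    R x + inner ℝ (∇ R x) (y - x) ≤ R y := by
  have hconv : ConvexOn ℝ (Icc (0 : ℝ) 1) (fun s : ℝ => R (x + s • (y - x))) := by
    have hmem : ∀ s ∈ Icc (0 : ℝ) 1, x + s • (y - x) ∈ interior X := fun s hs =>
      hR.convexOn.1.add_smul_sub_mem hx hy hs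
    refine ⟨convex_Icc 0 1, fun a ha b hb p q hp hq hpq => ?_⟩
    have := hR.convexOn.2 (hmem a ha) (hmem b hb) hp hq hpq
    convert this using 2
    have : q = 1 - p := by linarith
    subst this
    simp only [smul_eq_mul]
    module
  have hd := hR.hasDerivAt_line (x := x) (d := y - x) (s := 0) (by simpa using hx)
  have := hconv.le_slope_of_hasDerivAt (left_mem_Icc.2 zero_le_one) (right_mem_Icc.2 zero_le_one)
    zero_lt_one hd
  simp only [slope_def_field, zero_smul, one_smul, add_zero, add_sub_cancel, sub_zero,
    div_one] at this
  linarith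

theorem gradient_monotone (hR : IsSelfConcordantBarrier ν X R) {x y : Eucl n}
    (hx : x ∈ interior X) (hy : y ∈ interior X) :
    0 ≤ inner ℝ (∇ R x - ∇ R y) (x - y) := by
  have h1 := hR.inner_gradient_le hx hy
  have h2 := hR.inner_gradient_le hy hx
  rw [← neg_sub x y, inner_neg_right] at h1
  rw [inner_sub_left]
  linarith

theorem bregman_nonneg (hR : IsSelfConcordantBarrier ν X R) {x y : Eucl n}
    (hx : x ∈ interior X) (hy : y ∈ interior X) : 0 ≤ bregman R y x := by
  have := hR.inner_gradient_le hx hy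
  unfold bregman
  linarith

/-- The form is a limit of difference quotients of the monotone gradient along d. -/
theorem inner_hess_nonneg (hR : IsSelfConcordantBarrier ν X R) {x : Eucl n}
    (hx : x ∈ interior X) (d : Eucl n) : 0 ≤ inner ℝ d (hess R x d) := by
  have hd := hR.hasDerivAt_line_gradient (x := x) (d := d) (s := 0) (by simpa using hx)
  simp only [zero_smul, add_zero] at hd
  have hlim := hd.tendsto_slope_zero_right
  refine ge_of_tendsto hlim ?_
  have hc : ContinuousAt (fun s : ℝ => x + s • d) 0 := by fun_prop
  have hev : ∀ᶠ s : ℝ in 𝓝[>] 0, x + s • d ∈ interior X :=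
    nhdsWithin_le_nhds (hc (by simpa using isOpen_interior.mem_nhds hx))
  filter_upwards [hev, self_mem_nhdsWithin] with s hs hpos
  have hpos' : (0 : ℝ) < s := hpos
  have h1 := hR.gradient_monotone hs hx
  have h2 : x + s • d - x = s • d := by abel
  rw [h2, inner_smul_right, inner_sub_left] at h1
  have h3 := (mul_nonneg_iff_of_pos_left hpos').1 h1
  simp only [zero_add, zero_smul, add_zero, smul_eq_mul]
  exact mul_nonneg (inv_nonneg.2 hpos'.le) h3

end IsSelfConcordantBarrier

end

section

variable {n : ℕ} {ν : ℝ} {X : Set (Eucl n)} {R : Eucl n → ℝ}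

/-! ### Consequences of self-concordance -/

/-- The Hessian form may vanish, and then its power -1/2 is not defined. Adding a constant ε leaves
its derivative unchanged and only enlarges the right side of the self-concordance inequality, so the
one-variable lemmas apply to the shifted form. -/
theorem rpow_three_half_le {q ε : ℝ} (hq : 0 ≤ q) (hε : 0 ≤ ε) :
    q ^ (3 / 2 : ℝ) ≤ (q + ε) * √(q + ε) := by
  have h : q ^ (3 / 2 : ℝ) = q * √q := by
    rw [show (3 / 2 : ℝ) = 1 + 1 / 2 by norm_num, Real.rpow_add_of_nonneg hq (by norm_num)
      (by norm_num), Real.rpow_one, Real.sqrt_eq_rpow]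
  rw [h]
  have : √q ≤ √(q + ε) := Real.sqrt_le_sqrt (by linarith)
  gcongr
  linarith

namespace IsSelfConcordantBarrier

theorem abs_third_le (hR : IsSelfConcordantBarrier ν X R) {x : Eucl n} (hx : x ∈ interior X)
    (d : Eucl n) {ε : ℝ} (hε : 0 ≤ ε) :
    |iteratedFDeriv ℝ 3 R x (fun _ => d)| ≤
      2 * ((inner ℝ d (hess R x d) + ε) * √(inner ℝ d (hess R x d) + ε)) := by
  have h1 := hR.third_le x hx d
  have h2 := rpow_three_half_le (hR.inner_hess_nonneg hx d) hε
  linarith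

/-- The open Dikin ellipsoid is contained in the interior of the domain. -/
theorem add_mem_interior (hR : IsSelfConcordantBarrier ν X R) {x d : Eucl n}
    (hx : x ∈ interior X) (hd : inner ℝ d (hess R x d) < 1) : x + d ∈ interior X := by
  by_contra hcon
  -- Let `b` be the first parameter at which the segment leaves the interior. Before `b` the second
  -- derivative of `R` along the segment is bounded by self-concordance, so `R` is bounded there,
  -- against its blow-up at the boundary point x + bd.
  set S : Set ℝ := Icc 0 1 ∩ (fun s : ℝ => x + s • d) ⁻¹' (interior X)ᶜ with hS
  have hcont : Continuous fun s : ℝ => x + s • d := by fun_prop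
  have hScl : IsClosed S := isClosed_Icc.inter (isOpen_interior.isClosed_compl.preimage hcont)
  have hSne : S.Nonempty := ⟨1, by simp [hS, hcon]⟩
  have hSbd : BddBelow S := ⟨0, fun s hs => hs.1.1⟩
  set b := sInf S with hb
  have hbS : b ∈ S := hScl.csInf_mem hSne hSbd
  have hlt : ∀ s, 0 ≤ s → s < b → x + s • d ∈ interior X := by
    intro s h0 hs
    by_contra h
    exact absurd (csInf_le hSbd (show s ∈ S from ⟨⟨h0, hs.le.trans hbS.1.2⟩, h⟩)) (not_le.2 hs)
  have hb0 : 0 < b := by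
    refine lt_of_le_of_ne hbS.1.1 fun h => hbS.2 ?_
    simpa [← h] using hx
  have hI : ∀ᶠ s in 𝓝[<] b, s ∈ Ico 0 b := by
    filter_upwards [self_mem_nhdsWithin, nhdsWithin_le_nhds (Ioi_mem_nhds hb0)] with s h1 h2
    exact ⟨le_of_lt h2, h1⟩
  have htend : Tendsto (fun s : ℝ => x + s • d) (𝓝[<] b) (𝓝[interior X] (x + b • d)) := by
    refine tendsto_nhdsWithin_iff.2 ⟨hcont.continuousAt.tendsto.mono_left nhdsWithin_le_nhds, ?_⟩
    filter_upwards [hI] with s hs using hlt s hs.1 hs.2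
  have hfr : x + b • d ∈ frontier X := by
    refine ⟨?_, hbS.2⟩
    refine mem_closure_of_tendsto (tendsto_nhds_of_tendsto_nhdsWithin htend) ?_
    filter_upwards [hI] with s hs using interior_subset (hlt s hs.1 hs.2)
  have hinf := (hR.tendsto_boundary _ hfr).comp htend
  set q0 := inner ℝ d (hess R x d) with hq0
  -- Half of the slack: the shifted form is positive and still less than 1 at the start.
  set ε := (1 - q0) / 2 with hε
  have hq0' : 0 ≤ q0 := hR.inner_hess_nonneg hx d
  have hεpos : 0 < ε := by rw [hε]; linarith
  set a := √(q0 + ε) with ha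
  have ha1 : a < 1 := by
    rw [ha, Real.sqrt_lt' one_pos]; rw [hε]; linarith
  have ha0 : 0 < a := Real.sqrt_pos.2 (by linarith)
  have hbound : ∀ s ∈ Ico 0 b, R (x + s • d) ≤ R x + |inner ℝ (∇ R x) d| + (a / (1 - a)) ^ 2 := by
    intro s hs
    have hmem : ∀ r ∈ Icc 0 s, x + r • d ∈ interior X := fun r hr =>
      hlt r hr.1 (hr.2.trans_lt hs.2)
    have := le_of_snd_deriv_le (φ := fun s => R (x + s • d)) (M := (a / (1 - a)) ^ 2)
      (by positivity) hs.1 (hs.2.le.trans hbS.1.2)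
      (fun r hr => hR.hasDerivAt_line (hmem r hr))
      (fun r hr => hR.hasDerivAt_line_gradient (hmem r hr)) (fun r hr => ?_)
    · simpa using this
    · have hmem' : ∀ y ∈ Icc 0 r, x + y • d ∈ interior X := fun y hy =>
        hmem y ⟨hy.1, hy.2.trans hr.2⟩
      have h0 : inner ℝ d (hess R (x + (0 : ℝ) • d) d) + ε = q0 + ε := by simp [hq0]
      have hr1 : r ≤ 1 := hr.2.trans (hs.2.le.trans hbS.1.2)
      have hra : r * a ≤ a := by nlinarith
      have h1 := selfConcordant_le (q := fun r => inner ℝ d (hess R (x + r • d) d) + ε) hr.1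
        (fun y hy => (hR.hasDerivAt_line_hess (hmem' y hy)).add_const ε)
        (fun y hy => by have := hR.inner_hess_nonneg (hmem' y hy) d; linarith)
        (fun y hy => hR.abs_third_le (hmem' y hy) d hεpos.le)
        (by rw [h0, ← ha]; linarith)
      rw [h0, ← ha] at h1
      have h2 : (a / (1 - r * a)) ^ 2 ≤ (a / (1 - a)) ^ 2 := by
        have h3 : 0 < 1 - a := by linarith
        have h4 : 0 < 1 - r * a := by linarith
        gcongr
      linarith
  obtain ⟨s, h1, h2⟩ := ((hinf.eventually_gt_atTop
    (R x + |inner ℝ (∇ R x) d| + (a / (1 - a)) ^ 2)).and hI).exists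
  exact absurd (hbound s h2) (not_le.2 h1)

/-- Along the segment, `R` plus the quadratic has second derivative ⟨d, ∇²R d⟩ + c‖d‖². The
quadratic has no third derivative, so this sum is again self-concordant, and it is positive for d ≠
0. -/
theorem sub_log_le_bregman (hR : IsSelfConcordantBarrier ν X R) {x d : Eucl n}
    (hx : x ∈ interior X) (hxd : x + d ∈ interior X) {c : ℝ} (hc : 0 < c) :
    √(inner ℝ d (hess R x d) + c * ‖d‖ ^ 2) -
      Real.log (1 + √(inner ℝ d (hess R x d) + c * ‖d‖ ^ 2)) ≤
      bregman R (x + d) x + c / 2 * ‖d‖ ^ 2 := by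
  by_cases hd0 : d = 0
  · simp [hd0, bregman]
  have hdpos : 0 < c * ‖d‖ ^ 2 := by have := norm_pos_iff.2 hd0; positivity
  have hmem : ∀ s ∈ Icc (0 : ℝ) 1, x + s • d ∈ interior X := fun s hs => by
    simpa using hR.convexOn.1.add_smul_sub_mem hx hxd hs
  have key := sub_log_le_of_selfConcordant (Real.sqrt_nonneg (inner ℝ d (hess R x d) + c * ‖d‖ ^ 2))
    (φ := fun s => R (x + s • d) + c / 2 * ‖d‖ ^ 2 * s ^ 2)
    (φ' := fun s => inner ℝ (∇ R (x + s • d)) d + c * ‖d‖ ^ 2 * s)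
    (q := fun s => inner ℝ d (hess R (x + s • d) d) + c * ‖d‖ ^ 2)
    (fun s hs => by
      refine ((hR.hasDerivAt_line (hmem s hs)).add
        ((hasDerivAt_pow 2 s).const_mul (c / 2 * ‖d‖ ^ 2))).congr_deriv ?_
      simp only [Nat.cast_ofNat, Nat.add_one_sub_one, pow_one]
      ring)
    (fun s hs => by
      refine ((hR.hasDerivAt_line_gradient (hmem s hs)).add
        ((hasDerivAt_id s).const_mul (c * ‖d‖ ^ 2))).congr_deriv ?_
      ring)
    (fun s hs => by
      have hmem' : ∀ y ∈ Icc 0 s, x + y • d ∈ interior X := fun y hy =>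
        hmem y ⟨hy.1, hy.2.trans hs.2⟩
      have := le_of_selfConcordant
        (q := fun r => inner ℝ d (hess R (x + r • d) d) + c * ‖d‖ ^ 2) hs.1
        (fun y hy => (hR.hasDerivAt_line_hess (hmem' y hy)).add_const _)
        (fun y hy => by have := hR.inner_hess_nonneg (hmem' y hy) d; linarith)
        (fun y hy => hR.abs_third_le (hmem' y hy) d hdpos.le)
      simpa using this)
  simp only [one_smul, zero_smul, add_zero, mul_zero, one_pow, mul_one, ne_eq, OfNat.ofNat_ne_zero,
    not_false_eq_true, zero_pow] at key
  unfold bregman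
  rw [add_sub_cancel_left]
  linarith

/-- The point p may lie on the boundary, since the segment from x stays in the interior for s < 1.
The parameter is ν + 1 instead of ν because the one-variable bound divides by it and ν = 0 is
allowed. -/
theorem sub_le_log (hR : IsSelfConcordantBarrier ν X R) (hν : 0 ≤ ν) (hX : Convex ℝ X)
    {x p : Eucl n} (hx : x ∈ interior X) (hp : p ∈ X) {s : ℝ} (hs : s ∈ Ico (0 : ℝ) 1) :
    R (x + s • (p - x)) - R x ≤ (ν + 1) * Real.log (1 / (1 - s)) := by
  have hmem : ∀ s ∈ Ico (0 : ℝ) 1, x + s • (p - x) ∈ interior X := fun s hs => by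
    have := hX.add_smul_sub_mem_interior hp hx (t := 1 - s) ⟨by linarith [hs.2], by linarith [hs.1]⟩
    convert this using 1
    module
  have := sub_le_log_of_barrier (φ := fun s => R (x + s • (p - x))) (by linarith : 0 < ν + 1)
    (fun s hs => hR.hasDerivAt_line (hmem s hs))
    (fun s hs => hR.hasDerivAt_line_gradient (hmem s hs))
    (fun s hs => hR.inner_hess_nonneg (hmem s hs) _) (fun s hs => ?_) hs
  · simpa using this
  · have h1 := hR.first_le _ (hmem s hs) (p - x)
    have h2 := hR.inner_hess_nonneg (hmem s hs) (p - x)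
    have h3 := pow_le_pow_left₀ (abs_nonneg _) h1 2
    rw [sq_abs, mul_pow, Real.sq_sqrt hν, Real.sq_sqrt h2] at h3
    linarith

/-! ### Existence of minimizers and the prox-mapping -/

/-- A sublevel set of `R` + `u` cannot accumulate at the boundary, where `R` blows up while `u` is
bounded below on X. It is therefore closed in the compact set X, and the minimum is attained on it.
-/
theorem exists_isMinOn_add (hR : IsSelfConcordantBarrier ν X R) (hX : IsCompact X)
    (hne : (interior X).Nonempty) {u : Eucl n → ℝ} (hu : Continuous u) :
    ∃ y ∈ interior X, IsMinOn (fun y => R y + u y) (interior X) y := by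
  obtain ⟨y₀, hy₀⟩ := hne
  obtain ⟨m, hm⟩ := (hX.image hu).bddBelow
  have hRc : ContinuousOn R (interior X) := hR.contDiffOn.continuousOn
  set K : Set (Eucl n) := {y ∈ interior X | R y + u y ≤ R y₀ + u y₀} with hK
  have hKX : K ⊆ interior X := fun y hy => hy.1
  have hKcl : IsClosed K := by
    refine isClosed_of_closure_subset fun y hy => ?_
    have hyX : y ∈ X := closure_minimal (hKX.trans interior_subset) hX.isClosed hy
    have hne : (𝓝[K] y).NeBot := mem_closure_iff_nhdsWithin_neBot.1 hy
    have hyi : y ∈ interior X := by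
      by_contra hyi
      have h1 := (hR.tendsto_boundary y ⟨subset_closure hyX, hyi⟩).mono_left
        (nhdsWithin_mono y hKX)
      obtain ⟨w, h2, h3⟩ := ((h1.eventually_gt_atTop (R y₀ + u y₀ - m)).and
        self_mem_nhdsWithin).exists
      have := hm (mem_image_of_mem u (interior_subset h3.1))
      linarith [h3.2]
    refine ⟨hyi, ?_⟩
    have hc : Tendsto (fun y => R y + u y) (𝓝[K] y) (𝓝 (R y + u y)) :=
      ((hRc.continuousAt (isOpen_interior.mem_nhds hyi)).add hu.continuousAt).tendsto.mono_left
        nhdsWithin_le_nhds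
    refine le_of_tendsto hc ?_
    filter_upwards [self_mem_nhdsWithin] with w hw using hw.2
  have hKc : IsCompact K := hX.of_isClosed_subset hKcl (hKX.trans interior_subset)
  obtain ⟨y, hyK, hy⟩ := hKc.exists_isMinOn ⟨y₀, hy₀, le_rfl⟩
    ((hRc.mono hKX).add hu.continuousOn)
  refine ⟨y, hyK.1, fun w hw => ?_⟩
  by_cases h : w ∈ K
  · exact hy h
  · have : R y₀ + u y₀ < R w + u w := by
      by_contra! h'
      exact h ⟨hw, h'⟩
    exact hyK.2.trans this.le

theorem argmin_spec {S : Set (Eucl n)} {g : Eucl n → ℝ} (h : ∃ y ∈ S, IsMinOn g S y) :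
    argmin S g ∈ S ∧ IsMinOn g S (argmin S g) :=
  Classical.epsilon_spec (p := fun y => y ∈ S ∧ IsMinOn g S y) h

theorem argmin_mem (hR : IsSelfConcordantBarrier ν X R) (hX : IsCompact X)
    (hne : (interior X).Nonempty) : argmin (interior X) R ∈ interior X := by
  obtain ⟨y, hy, h⟩ := hR.exists_isMinOn_add hX hne (u := fun _ => 0) continuous_const
  exact (argmin_spec ⟨y, hy, by simpa using h⟩).1

theorem gradient_argmin (hR : IsSelfConcordantBarrier ν X R) (hX : IsCompact X)
    (hne : (interior X).Nonempty) : ∇ R (argmin (interior X) R) = 0 := by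
  obtain ⟨y, hy, h⟩ := hR.exists_isMinOn_add hX hne (u := fun _ => 0) continuous_const
  obtain ⟨h1, h2⟩ := argmin_spec (g := R) ⟨y, hy, by simpa using h⟩
  have := (h2.isLocalMin (isOpen_interior.mem_nhds h1)).hasFDerivAt_eq_zero
    (hR.hasGradientAt h1).hasFDerivAt
  rwa [map_eq_zero_iff _ (InnerProductSpace.toDual ℝ (Eucl n)).injective] at this

/-- Stationarity of the objective at its interior minimizer. Nothing else about the prox-mapping is
used later. -/
theorem prox_spec (hR : IsSelfConcordantBarrier ν X R) (hX : IsCompact X)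
    (hne : (interior X).Nonempty) (β : ℝ) (t : ℕ) (x v : Eucl n) (η : ℝ) :
    prox X R β t x v η ∈ interior X ∧
      η • v = (η * β * ((t : ℝ) + 1)) • (prox X R β t x v η - x) +
        (∇ R (prox X R β t x v η) - ∇ R x) := by
  set c := η * β * ((t : ℝ) + 1) with hc
  -- All of the objective except `R` at the variable point.
  set u : Eucl n → ℝ := fun x' => η * inner ℝ v (x - x') + c / 2 * ‖x - x'‖ ^ 2 -
    R x - inner ℝ (∇ R x) (x' - x) with hu
  have hfun : (fun x' => η * inner ℝ v (x - x') + c / 2 * ‖x - x'‖ ^ 2 + bregman R x' x) =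
      fun x' => R x' + u x' := by
    funext x'; simp only [hu, bregman]; ring
  obtain ⟨h1, h2⟩ := argmin_spec (hR.exists_isMinOn_add hX hne (u := u) (by fun_prop))
  have hprox : prox X R β t x v η = argmin (interior X) fun x' => R x' + u x' := by
    rw [← hfun]; rfl
  rw [hprox]
  set y := argmin (interior X) fun x' => R x' + u x' with hy
  refine ⟨h1, ?_⟩
  have hlin : HasGradientAt u (-(η • v) + c • (y - x) - ∇ R x) y := by
    rw [hasGradientAt_iff_hasFDerivAt]
    have e1 : HasFDerivAt (fun x' : Eucl n => x - x') (-ContinuousLinearMap.id ℝ (Eucl n)) y :=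
      (hasFDerivAt_id y).const_sub x
    have e2 := ((innerSL ℝ v).hasFDerivAt.comp y e1).const_mul η
    have e3 := (e1.norm_sq).const_mul (c / 2)
    have e4 := (innerSL ℝ (∇ R x)).hasFDerivAt.comp y ((hasFDerivAt_id y).sub_const x)
    refine (((e2.add e3).sub_const (R x)).sub e4).congr_fderiv ?_
    ext w
    simp
    ring
  have := (h2.isLocalMin (isOpen_interior.mem_nhds h1)).hasFDerivAt_eq_zero
    ((hR.hasGradientAt h1).hasFDerivAt.add hlin.hasFDerivAt)
  rw [← map_add, map_eq_zero_iff _ (InnerProductSpace.toDual ℝ (Eucl n)).injective] at this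
  rw [← sub_eq_zero, ← neg_eq_zero, ← this]
  abel

theorem prox_mem (hR : IsSelfConcordantBarrier ν X R) (hX : IsCompact X)
    (hne : (interior X).Nonempty) (β : ℝ) (t : ℕ) (x v : Eucl n) (η : ℝ) :
    prox X R β t x v η ∈ interior X :=
  (hR.prox_spec hX hne β t x v η).1

/-- The prox-mapping is continuous in the pivot and the gradient estimate. -/
theorem continuous_prox (hR : IsSelfConcordantBarrier ν X R) (hX : IsCompact X)
    (hne : (interior X).Nonempty) {β : ℝ} {t : ℕ} {η : ℝ} (hc : 0 < η * β * ((t : ℝ) + 1))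
    {Z : Type*} [TopologicalSpace Z] {x v : Z → Eucl n} (hx : Continuous x)
    (hxX : ∀ ζ, x ζ ∈ interior X) (hv : Continuous v) :
    Continuous fun ζ => prox X R β t (x ζ) (v ζ) η := by
  set c := η * β * ((t : ℝ) + 1) with hcdef
  set w : Z → Eucl n := fun ζ => η • v ζ + c • x ζ + ∇ R (x ζ) with hw
  have hwc : Continuous w := by
    have : Continuous fun ζ => ∇ R (x ζ) := hR.continuousOn_gradient.comp_continuous hx hxX
    fun_prop
  -- The optimality condition reads c·y + ∇R(y) = w. As ∇R is monotone, the left side is strongly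
  -- monotone with modulus c, so its inverse is Lipschitz with constant 1/c.
  have hlip : ∀ ζ ζ', c * ‖prox X R β t (x ζ) (v ζ) η - prox X R β t (x ζ') (v ζ') η‖ ≤
      ‖w ζ - w ζ'‖ := by
    intro ζ ζ'
    obtain ⟨h1, h2⟩ := hR.prox_spec hX hne β t (x ζ) (v ζ) η
    obtain ⟨h1', h2'⟩ := hR.prox_spec hX hne β t (x ζ') (v ζ') η
    rw [← hcdef] at h2 h2'
    set y := prox X R β t (x ζ) (v ζ) η
    set y' := prox X R β t (x ζ') (v ζ') η
    have h3 : w ζ - w ζ' = c • (y - y') + (∇ R y - ∇ R y') := by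
      simp only [hw, h2, h2']
      module
    have h4 := hR.gradient_monotone h1 h1'
    have h5 : c * ‖y - y'‖ ^ 2 ≤ inner ℝ (w ζ - w ζ') (y - y') := by
      rw [h3, inner_add_left, inner_smul_left, real_inner_self_eq_norm_sq]
      simpa using h4
    have h6 := h5.trans (real_inner_le_norm _ _)
    by_cases h0 : ‖y - y'‖ = 0
    · rw [h0, mul_zero]; positivity
    · have : 0 < ‖y - y'‖ := lt_of_le_of_ne (norm_nonneg _) (Ne.symm h0)
      nlinarith
  refine continuous_iff_continuousAt.2 fun ζ => ?_
  rw [ContinuousAt, tendsto_iff_norm_sub_tendsto_zero]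
  have hlim : Tendsto (fun ζ' => ‖w ζ' - w ζ‖ / c) (𝓝 ζ) (𝓝 0) := by
    have := (tendsto_iff_norm_sub_tendsto_zero.1 (hwc.tendsto ζ)).div_const c
    simpa using this
  refine squeeze_zero (fun _ => norm_nonneg _) (fun ζ' => ?_) hlim
  rw [le_div_iff₀ hc]
  linarith [hlip ζ' ζ]

end IsSelfConcordantBarrier

end

section

/-! ### The inverse square root of a positive definite matrix -/

/-- For symmetric D the trace of D² is the squared Frobenius norm. -/
theorem sq_apply_le_trace {m : Type*} [Fintype m] {D : Matrix m m ℝ} (hD : D.IsHermitian) (i j : m) :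
    D i j ^ 2 ≤ (D * D).trace := by
  have h : (D * D).trace = ∑ i, ∑ j, D i j ^ 2 := by
    simp only [Matrix.trace, Matrix.diag, Matrix.mul_apply]
    refine Finset.sum_congr rfl fun i _ => Finset.sum_congr rfl fun j _ => ?_
    rw [← hD.apply i j, sq]
    simp
  rw [h]
  calc D i j ^ 2 ≤ ∑ j, D i j ^ 2 :=
        Finset.single_le_sum (f := fun j => D i j ^ 2) (fun _ _ => sq_nonneg _) (Finset.mem_univ j)
    _ ≤ _ := Finset.single_le_sum (f := fun i => ∑ j, D i j ^ 2)
        (fun _ _ => Finset.sum_nonneg fun _ _ => sq_nonneg _) (Finset.mem_univ i)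

section Matrix

variable {m : Type*} [DecidableEq m]

theorem isHermitian_of_posSemidef_sub {B : Matrix m m ℝ} {c : ℝ} (hB : (B - c • 1).PosSemidef) :
    B.IsHermitian := by
  have h := hB.1.add ((Matrix.isHermitian_one (n := m) (α := ℝ)).smul (IsSelfAdjoint.all c))
  simpa using h

variable [Fintype m]

theorem le_of_mem_spectrum {B : Matrix m m ℝ} {c : ℝ} (hB : (B - c • 1).PosSemidef) {r : ℝ}
    (hr : r ∈ spectrum ℝ B) : c ≤ r := by
  have h1 := (Matrix.posSemidef_iff_isHermitian_and_spectrum_nonneg.1 hB).2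
  have h2 : r - c ∈ spectrum ℝ (B - c • 1) := by
    rw [← sub_add_cancel r c, spectrum.add_mem_iff, Algebra.algebraMap_eq_smul_one,
      neg_add_eq_sub] at hr
    exact hr
  have := h1 h2
  simp only [mem_ofPred_eq] at this
  linarith

/-- The spectrum is finite, hence discrete, so the functional calculus imposes no continuity
condition here. -/
theorem continuousOn_spectrum (B : Matrix m m ℝ) (f : ℝ → ℝ) :
    ContinuousOn f (spectrum ℝ B) := by
  rw [continuousOn_iff_continuous_domRestrict]
  have : Finite (spectrum ℝ B) := Matrix.finite_real_spectrum.to_subtype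
  exact continuous_of_discreteTopology

theorem cfc_inv_sqrt_mul_cfc_sqrt {B : Matrix m m ℝ} {c : ℝ} (hc : 0 < c)
    (hB : (B - c • 1).PosSemidef) :
    cfc (fun r : ℝ => (√r)⁻¹) B * cfc (fun r : ℝ => √r) B = 1 := by
  have hsa : IsSelfAdjoint B := isHermitian_of_posSemidef_sub hB
  rw [← cfc_mul _ _ B (continuousOn_spectrum B _) (continuousOn_spectrum B _),
    ← cfc_const_one ℝ B]
  refine cfc_congr fun r hr => ?_
  have : 0 < r := hc.trans_le (le_of_mem_spectrum hB hr)
  exact inv_mul_cancel₀ (Real.sqrt_pos.2 this).ne'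

theorem cfc_inv_sqrt_inv {B : Matrix m m ℝ} {c : ℝ} (hc : 0 < c)
    (hB : (B - c • 1).PosSemidef) :
    (cfc (fun r : ℝ => (√r)⁻¹) B)⁻¹ = cfc (fun r : ℝ => √r) B :=
  Matrix.inv_eq_right_inv (cfc_inv_sqrt_mul_cfc_sqrt hc hB)

theorem cfc_sqrt_mul_self {B : Matrix m m ℝ} {c : ℝ} (hc : 0 < c)
    (hB : (B - c • 1).PosSemidef) :
    cfc (fun r : ℝ => √r) B * cfc (fun r : ℝ => √r) B = B := by
  have hsa : IsSelfAdjoint B := isHermitian_of_posSemidef_sub hB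
  rw [← cfc_mul _ _ B (continuousOn_spectrum B _) (continuousOn_spectrum B _)]
  conv_rhs => rw [← cfc_id' ℝ B]
  refine cfc_congr fun r hr => ?_
  exact Real.mul_self_sqrt (hc.le.trans (le_of_mem_spectrum hB hr))

/-- On the spectrum √r - √c is nonnegative, so the difference is the square of a symmetric matrix
obtained by functional calculus. -/
theorem cfc_sqrt_sub_posSemidef {B : Matrix m m ℝ} {c : ℝ}
    (hB : (B - c • 1).PosSemidef) :
    (cfc (fun r : ℝ => √r) B - √c • 1).PosSemidef := by
  have hsa : IsSelfAdjoint B := isHermitian_of_posSemidef_sub hB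
  have h1 : cfc (fun r : ℝ => √r) B - √c • 1 =
      cfc (fun r : ℝ => √(√r - √c)) B * cfc (fun r : ℝ => √(√r - √c)) B := by
    rw [← Algebra.algebraMap_eq_smul_one, ← cfc_const (√c) B,
      ← cfc_sub _ _ B (continuousOn_spectrum B _) (continuousOn_spectrum B _),
      ← cfc_mul _ _ B (continuousOn_spectrum B _) (continuousOn_spectrum B _)]
    refine cfc_congr fun r hr => ?_
    exact (Real.mul_self_sqrt (sub_nonneg.2
      (Real.sqrt_le_sqrt (le_of_mem_spectrum hB hr)))).symm
  have h2 : (cfc (fun r : ℝ => √(√r - √c)) B).IsHermitian :=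
    cfc_predicate (p := IsSelfAdjoint) (fun r : ℝ => √(√r - √c)) B
  rw [h1]
  nth_rw 1 [← h2.eq]
  exact Matrix.posSemidef_conjTranspose_mul_self _

theorem isHermitian_cfc (f : ℝ → ℝ) (B : Matrix m m ℝ) : (cfc f B).IsHermitian :=
  cfc_predicate (p := IsSelfAdjoint) f B

/-- The square root is Lipschitz, for the Frobenius norm, on matrices bounded below. -/
theorem trace_sq_sub_le {S S' : Matrix m m ℝ} {r : ℝ} (hr : 0 < r)
    (hS : (S - r • 1).PosSemidef) (hS' : (S' - r • 1).PosSemidef) :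
    4 * r ^ 2 * ((S - S') * (S - S')).trace ≤
      ((S * S - S' * S') * (S * S - S' * S')).trace := by
  have hSh := isHermitian_of_posSemidef_sub hS
  have hSh' := isHermitian_of_posSemidef_sub hS'
  obtain ⟨D, hD⟩ : ∃ D, D = S - S' := ⟨_, rfl⟩
  have hDh : D.IsHermitian := hD ▸ hSh.sub hSh'
  obtain ⟨E, hE⟩ : ∃ E, E = S * S - S' * S' := ⟨_, rfl⟩
  rw [← hD, ← hE]
  have hEh : E.IsHermitian := by
    rw [hE]
    refine Matrix.IsHermitian.sub ?_ ?_
    · rw [Matrix.IsHermitian, Matrix.conjTranspose_mul, hSh.eq]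
    · rw [Matrix.IsHermitian, Matrix.conjTranspose_mul, hSh'.eq]
  -- The difference of squares, factored without commutativity.
  have hED : E = S * D + D * S' := by rw [hE, hD]; noncomm_ring
  have key : ∀ {S : Matrix m m ℝ}, (S - r • 1).PosSemidef →
      r * (D * D).trace ≤ (D * S * D).trace := by
    intro S hS
    have := (hS.conjTranspose_mul_mul_same D).trace_nonneg
    rw [hDh.eq, mul_sub, sub_mul, Matrix.trace_sub] at this
    rw [Matrix.mul_smul, mul_one, Matrix.smul_mul, Matrix.trace_smul, smul_eq_mul] at this
    linarith
  have h1 := key hS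
  have h2 := key hS'
  have h3 : (D * E).trace = (D * S * D).trace + (D * S' * D).trace := by
    rw [hED, mul_add, Matrix.trace_add, ← mul_assoc, ← mul_assoc, Matrix.trace_mul_comm (D * D),
      Matrix.trace_mul_comm (D * S') D, ← mul_assoc, Matrix.trace_mul_comm (S' * D), ← mul_assoc,
      ← mul_assoc]
    congr 1
    rw [Matrix.trace_mul_comm, ← mul_assoc, mul_assoc D D, Matrix.trace_mul_comm, mul_assoc]
  -- From tr (E - 2rD)² ≥ 0 and tr(DE) ≥ 2r tr D² follows tr E² ≥ 4r tr(DE) - 4r² tr D² ≥ 4r² tr D².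
  have h4 := (Matrix.posSemidef_conjTranspose_mul_self (E - (2 * r) • D)).trace_nonneg
  rw [(hEh.sub (hDh.smul (IsSelfAdjoint.all (2 * r)))).eq] at h4
  simp only [mul_sub, sub_mul, Matrix.trace_sub, Matrix.mul_smul, Matrix.smul_mul,
    Matrix.trace_smul, smul_eq_mul, Matrix.trace_mul_comm E D] at h4
  nlinarith

theorem continuous_cfc_sqrt {Z : Type*} [TopologicalSpace Z] {B : Z → Matrix m m ℝ}
    (hBc : Continuous B) {c : ℝ} (hc : 0 < c) (hB : ∀ ζ, (B ζ - c • 1).PosSemidef) :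
    Continuous fun ζ => cfc (fun r : ℝ => √r) (B ζ) := by
  refine continuous_matrix fun i j => continuous_iff_continuousAt.2 fun ζ₀ => ?_
  have hlim : Tendsto (fun ζ => √(((B ζ - B ζ₀) * (B ζ - B ζ₀)).trace / (4 * c))) (𝓝 ζ₀) (𝓝 0) := by
    have : Continuous fun ζ => √(((B ζ - B ζ₀) * (B ζ - B ζ₀)).trace / (4 * c)) := by fun_prop
    simpa using this.tendsto ζ₀
  rw [ContinuousAt, tendsto_iff_norm_sub_tendsto_zero]
  refine squeeze_zero (fun _ => norm_nonneg _) (fun ζ => ?_) hlim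
  have h1 := trace_sq_sub_le (Real.sqrt_pos.2 hc) (cfc_sqrt_sub_posSemidef (hB ζ))
    (cfc_sqrt_sub_posSemidef (hB ζ₀))
  rw [cfc_sqrt_mul_self hc (hB ζ), cfc_sqrt_mul_self hc (hB ζ₀), Real.sq_sqrt hc.le] at h1
  have h2 := sq_apply_le_trace ((isHermitian_cfc (fun r : ℝ => √r) (B ζ)).sub
    (isHermitian_cfc (fun r : ℝ => √r) (B ζ₀))) i j
  rw [Real.norm_eq_abs]
  refine Real.abs_le_sqrt ?_
  rw [le_div_iff₀ (by positivity)]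
  simp only [Matrix.sub_apply] at h2
  nlinarith

end Matrix

/-! ### The scaling operators -/

variable {n : ℕ} {ν : ℝ} {X : Set (Eucl n)} {R : Eucl n → ℝ}

theorem toEuclideanCLM_hessMatrix (R : Eucl n → ℝ) (x : Eucl n) :
    Matrix.toEuclideanCLM (𝕜 := ℝ) (hessMatrix R x) = hess R x :=
  StarAlgEquiv.apply_symm_apply _ _

theorem inner_toEuclideanCLM_comm {A : Matrix (Fin n) (Fin n) ℝ} (hA : A.IsHermitian)
    (u v : Eucl n) : inner ℝ (Matrix.toEuclideanCLM (𝕜 := ℝ) A u) v =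
      inner ℝ u (Matrix.toEuclideanCLM (𝕜 := ℝ) A v) := by
  have h : IsSelfAdjoint (Matrix.toEuclideanCLM (n := Fin n) (𝕜 := ℝ) A) := by
    rw [IsSelfAdjoint, ← map_star]
    exact congrArg _ hA
  exact (ContinuousLinearMap.isSelfAdjoint_iff_isSymmetric.1 h) u v

namespace IsSelfConcordantBarrier

theorem hessMatrix_posSemidef (hR : IsSelfConcordantBarrier ν X R) {x : Eucl n}
    (hx : x ∈ interior X) : (hessMatrix R x).PosSemidef := by
  have h1 : IsSelfAdjoint (hess R x) :=
    ContinuousLinearMap.isSelfAdjoint_iff_isSymmetric.2 fun u v => hR.inner_hess_comm hx u v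
  refine Matrix.PosSemidef.of_dotProduct_mulVec_nonneg ?_ fun v => ?_
  · have : star (hessMatrix R x) = hessMatrix R x := by
      apply EquivLike.injective (Matrix.toEuclideanCLM (n := Fin n) (𝕜 := ℝ))
      rw [map_star, toEuclideanCLM_hessMatrix, h1.star_eq]
    exact this
  · have := hR.inner_hess_nonneg hx (WithLp.toLp 2 v)
    rw [← toEuclideanCLM_hessMatrix, Matrix.inner_toEuclideanCLM] at this
    simpa using this

theorem posSemidef_sub (hR : IsSelfConcordantBarrier ν X R) {x : Eucl n}
    (hx : x ∈ interior X) (c : ℝ) : (hessMatrix R x + c • 1 - c • 1).PosSemidef := by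
  rw [add_sub_cancel_right]
  exact hR.hessMatrix_posSemidef hx

section Scaling

variable {β η : ℝ} {t : ℕ} {x : Eucl n}

theorem scaling_mul_inv (hR : IsSelfConcordantBarrier ν X R)
    (hc : 0 < η * β * ((t : ℝ) + 1)) (hx : x ∈ interior X) :
    scaling R β t x η * (scaling R β t x η)⁻¹ = 1 := by
  rw [scaling, cfc_inv_sqrt_inv hc (hR.posSemidef_sub hx _)]
  exact cfc_inv_sqrt_mul_cfc_sqrt hc (hR.posSemidef_sub hx _)

theorem scaling_inv_apply (hR : IsSelfConcordantBarrier ν X R)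
    (hc : 0 < η * β * ((t : ℝ) + 1)) (hx : x ∈ interior X) (v : Eucl n) :
    Matrix.toEuclideanCLM (𝕜 := ℝ) (scaling R β t x η)⁻¹
      (Matrix.toEuclideanCLM (𝕜 := ℝ) (scaling R β t x η) v) = v := by
  have h := mul_eq_one_comm.1 (hR.scaling_mul_inv hc hx)
  rw [← mul_apply_eq_comp, ← map_mul, h, map_one, one_apply_eq_self]

theorem scaling_apply_inv (hR : IsSelfConcordantBarrier ν X R)
    (hc : 0 < η * β * ((t : ℝ) + 1)) (hx : x ∈ interior X) (v : Eucl n) :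
    Matrix.toEuclideanCLM (𝕜 := ℝ) (scaling R β t x η)
      (Matrix.toEuclideanCLM (𝕜 := ℝ) (scaling R β t x η)⁻¹ v) = v := by
  rw [← mul_apply_eq_comp, ← map_mul, hR.scaling_mul_inv hc hx, map_one,
    one_apply_eq_self]

theorem isHermitian_scaling_inv (R : Eucl n → ℝ) (β η : ℝ) (t : ℕ) (x : Eucl n) :
    ((scaling R β t x η)⁻¹).IsHermitian :=
  (isHermitian_cfc _ _).inv

/-- The inverse scaling is the symmetric square root of ∇²R(x) + cI, so its norm is the local norm
in which the mirror step is measured. -/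
theorem norm_scaling_inv_sq (hR : IsSelfConcordantBarrier ν X R)
    (hc : 0 < η * β * ((t : ℝ) + 1)) (hx : x ∈ interior X) (d : Eucl n) :
    ‖Matrix.toEuclideanCLM (𝕜 := ℝ) (scaling R β t x η)⁻¹ d‖ ^ 2 =
      inner ℝ d (hess R x d) + η * β * ((t : ℝ) + 1) * ‖d‖ ^ 2 := by
  rw [← real_inner_self_eq_norm_sq, inner_toEuclideanCLM_comm (isHermitian_scaling_inv R β η t x),
    ← mul_apply_eq_comp, ← map_mul, scaling,
    cfc_inv_sqrt_inv hc (hR.posSemidef_sub hx _), cfc_sqrt_mul_self hc (hR.posSemidef_sub hx _),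
    map_add, toEuclideanCLM_hessMatrix, map_smul, map_one]
  simp [inner_add_right, inner_smul_right]

theorem norm_sq_eq_scaling (hR : IsSelfConcordantBarrier ν X R)
    (hc : 0 < η * β * ((t : ℝ) + 1)) (hx : x ∈ interior X) (z : Eucl n) :
    inner ℝ (Matrix.toEuclideanCLM (𝕜 := ℝ) (scaling R β t x η) z)
      (hess R x (Matrix.toEuclideanCLM (𝕜 := ℝ) (scaling R β t x η) z)) +
      η * β * ((t : ℝ) + 1) * ‖Matrix.toEuclideanCLM (𝕜 := ℝ) (scaling R β t x η) z‖ ^ 2 =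
      ‖z‖ ^ 2 := by
  rw [← hR.norm_scaling_inv_sq hc hx, hR.scaling_inv_apply hc hx]

theorem norm_scaling_sq_le (hR : IsSelfConcordantBarrier ν X R)
    (hc : 0 < η * β * ((t : ℝ) + 1)) (hx : x ∈ interior X) {z : Eucl n} (hz : ‖z‖ ≤ 1) :
    ‖Matrix.toEuclideanCLM (𝕜 := ℝ) (scaling R β t x η) z‖ ^ 2 ≤ 1 / (η * β * ((t : ℝ) + 1)) := by
  have h1 := hR.norm_sq_eq_scaling hc hx z
  have h2 := hR.inner_hess_nonneg hx (Matrix.toEuclideanCLM (𝕜 := ℝ) (scaling R β t x η) z)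
  have h3 : ‖z‖ ^ 2 ≤ 1 := by nlinarith [norm_nonneg z]
  rw [le_div_iff₀ hc]
  linarith

/-- The Hessian form at Az equals ‖z‖² - c‖Az‖². The regularization makes this strictly less than 1
even on the unit sphere, which places the point in the open Dikin ellipsoid. -/
theorem play_mem_interior (hR : IsSelfConcordantBarrier ν X R)
    (hc : 0 < η * β * ((t : ℝ) + 1)) (hx : x ∈ interior X) {z : Eucl n} (hz : ‖z‖ ≤ 1) :
    play R β t x z η ∈ interior X := by
  refine hR.add_mem_interior hx ?_
  have h1 := hR.norm_sq_eq_scaling hc hx z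
  have h3 : ‖z‖ ^ 2 ≤ 1 := by nlinarith [norm_nonneg z]
  by_cases h0 : Matrix.toEuclideanCLM (𝕜 := ℝ) (scaling R β t x η) z = 0
  · simp [h0]
  · have := mul_pos hc (pow_pos (norm_pos_iff.2 h0) 2)
    linarith

variable {Z : Type*} [TopologicalSpace Z] {y : Z → Eucl n}

theorem continuous_scaling_inv (hR : IsSelfConcordantBarrier ν X R)
    (hc : 0 < η * β * ((t : ℝ) + 1)) (hy : Continuous y) (hyX : ∀ ζ, y ζ ∈ interior X) :
    Continuous fun ζ => (scaling R β t (y ζ) η)⁻¹ := by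
  have h1 : Continuous fun ζ => hess R (y ζ) := hR.continuousOn_hess.comp_continuous hy hyX
  have h2 : Continuous fun ζ => hessMatrix R (y ζ) :=
    (LinearMap.continuous_of_finiteDimensional
      (Matrix.toEuclideanCLM (n := Fin n) (𝕜 := ℝ)).symm.toAlgEquiv.toLinearMap).comp h1
  simp only [scaling, fun ζ => cfc_inv_sqrt_inv hc (hR.posSemidef_sub (hyX ζ) _)]
  exact continuous_cfc_sqrt (h2.add continuous_const) hc fun ζ => hR.posSemidef_sub (hyX ζ) _

theorem continuous_scaling (hR : IsSelfConcordantBarrier ν X R)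
    (hc : 0 < η * β * ((t : ℝ) + 1)) (hy : Continuous y) (hyX : ∀ ζ, y ζ ∈ interior X) :
    Continuous fun ζ => scaling R β t (y ζ) η := by
  have h1 := hR.continuous_scaling_inv hc hy hyX
  -- Cramer's rule carries continuity from the inverse, where the square root was treated, to the
  -- scaling itself.
  have h2 : ∀ ζ, scaling R β t (y ζ) η = ((scaling R β t (y ζ) η)⁻¹).det⁻¹ •
      ((scaling R β t (y ζ) η)⁻¹).adjugate := fun ζ => by
    rw [← Ring.inverse_eq_inv', ← Matrix.inv_def]
    exact (Matrix.inv_eq_left_inv (hR.scaling_mul_inv hc (hyX ζ))).symm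
  rw [funext h2]
  refine (h1.matrix_det.inv₀ fun ζ => ?_).smul h1.matrix_adjugate
  have := congrArg Matrix.det (hR.scaling_mul_inv hc (hyX ζ))
  rw [Matrix.det_mul, Matrix.det_one] at this
  exact right_ne_zero_of_mul_eq_one this

theorem continuous_toEuclideanCLM_apply {A : Z → Matrix (Fin n) (Fin n) ℝ} {v : Z → Eucl n}
    (hA : Continuous A) (hv : Continuous v) :
    Continuous fun ζ => Matrix.toEuclideanCLM (𝕜 := ℝ) (A ζ) (v ζ) := by
  have : Continuous fun ζ => Matrix.toEuclideanCLM (n := Fin n) (𝕜 := ℝ) (A ζ) :=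
    (LinearMap.continuous_of_finiteDimensional
      (Matrix.toEuclideanCLM (n := Fin n) (𝕜 := ℝ)).toAlgEquiv.toLinearMap).comp hA
  exact this.clm_apply hv

theorem continuous_play (hR : IsSelfConcordantBarrier ν X R)
    (hc : 0 < η * β * ((t : ℝ) + 1)) (hy : Continuous y) (hyX : ∀ ζ, y ζ ∈ interior X)
    {z : Z → Eucl n} (hz : Continuous z) : Continuous fun ζ => play R β t (y ζ) (z ζ) η :=
  hy.add (continuous_toEuclideanCLM_apply (hR.continuous_scaling hc hy hyX) hz)

theorem continuous_gradEst (hR : IsSelfConcordantBarrier ν X R)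
    (hc : 0 < η * β * ((t : ℝ) + 1)) (hy : Continuous y) (hyX : ∀ ζ, y ζ ∈ interior X)
    {z : Z → Eucl n} (hz : Continuous z) (hz1 : ∀ ζ, ‖z ζ‖ ≤ 1) {f : Eucl n → ℝ}
    (hf : ContinuousOn f (interior X)) :
    Continuous fun ζ => gradEst R β t f (y ζ) (z ζ) η := by
  have h1 : Continuous fun ζ => f (play R β t (y ζ) (z ζ) η) :=
    hf.comp_continuous (hR.continuous_play hc hy hyX hz)
      fun ζ => hR.play_mem_interior hc (hyX ζ) (hz1 ζ)
  exact (continuous_const.mul h1).smul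
    (continuous_toEuclideanCLM_apply (hR.continuous_scaling_inv hc hy hyX) hz)

end Scaling

end IsSelfConcordantBarrier

end

section

/-! ### The divergence theorem on the unit ball -/

/-- A smooth radial cutoff of the unit ball, equal to `1` away from the boundary layer of
width about `1 / k`. -/
def radialCutoff (k : ℕ) (ρ : ℝ) : ℝ := Real.smoothTransition (((k : ℝ) + 1) * (1 - ρ))

theorem contDiff_radialCutoff (k : ℕ) : ContDiff ℝ 1 (radialCutoff k) :=
  (Real.smoothTransition.contDiff (n := 1)).comp (by fun_prop)

theorem radialCutoff_nonneg (k : ℕ) (ρ : ℝ) : 0 ≤ radialCutoff k ρ :=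
  Real.smoothTransition.nonneg _

theorem radialCutoff_le_one (k : ℕ) (ρ : ℝ) : radialCutoff k ρ ≤ 1 :=
  Real.smoothTransition.le_one _

theorem radialCutoff_of_one_le (k : ℕ) {ρ : ℝ} (hρ : 1 ≤ ρ) : radialCutoff k ρ = 0 :=
  Real.smoothTransition.zero_of_nonpos (mul_nonpos_of_nonneg_of_nonpos (by positivity)
    (by linarith))

theorem radialCutoff_zero (k : ℕ) : radialCutoff k 0 = 1 :=
  Real.smoothTransition.one_of_one_le (by simp)

theorem deriv_radialCutoff_of_one_lt (k : ℕ) {ρ : ℝ} (hρ : 1 < ρ) :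
    deriv (radialCutoff k) ρ = 0 := by
  have h : radialCutoff k =ᶠ[𝓝 ρ] fun _ => 0 := by
    filter_upwards [Ioi_mem_nhds hρ] with s hs using radialCutoff_of_one_le k (le_of_lt hs)
  rw [h.deriv_eq, deriv_const]

theorem tendsto_radialCutoff {ρ : ℝ} (hρ : ρ < 1) :
    Tendsto (fun k => radialCutoff k ρ) atTop (𝓝 1) := by
  refine tendsto_const_nhds.congr' ?_
  have h : Tendsto (fun k : ℕ => ((k : ℝ) + 1) * (1 - ρ)) atTop atTop :=
    (tendsto_atTop_add_const_right _ _ tendsto_natCast_atTop_atTop).atTop_mul_const (by linarith)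
  filter_upwards [h.eventually_ge_atTop 1] with k hk
  exact (Real.smoothTransition.one_of_one_le hk).symm

theorem hasDerivAt_radialCutoff_sq (k : ℕ) (r : ℝ) :
    HasDerivAt (fun r : ℝ => radialCutoff k (r ^ 2)) (deriv (radialCutoff k) (r ^ 2) * (2 * r)) r := by
  have h1 : HasDerivAt (radialCutoff k) (deriv (radialCutoff k) (r ^ 2)) (r ^ 2) :=
    ((contDiff_radialCutoff k).differentiable (by norm_num)).differentiableAt.hasDerivAt
  have h2 : HasDerivAt (fun r : ℝ => r ^ 2) (2 * r) r := by simpa using hasDerivAt_pow 2 r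
  exact HasDerivAt.comp (h := fun r : ℝ => r ^ 2) r h1 h2

theorem continuous_deriv_radialCutoff (k : ℕ) : Continuous (deriv (radialCutoff k)) :=
  (contDiff_radialCutoff k).continuous_deriv le_rfl

/-- The radial derivatives of the cutoffs converge to minus the evaluation at `1`. -/
theorem integral_mul_deriv_radialCutoff {M M' : ℝ → ℝ} (hM : ∀ r, HasDerivAt M (M' r) r)
    (hM' : Continuous M') (k : ℕ) :
    ∫ r in (0 : ℝ)..1, M r * (deriv (radialCutoff k) (r ^ 2) * (2 * r)) =
      -M 0 - ∫ r in (0 : ℝ)..1, M' r * radialCutoff k (r ^ 2) := by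
  have hc := continuous_deriv_radialCutoff k
  rw [intervalIntegral.integral_mul_deriv_eq_deriv_mul (fun r _ => hM r)
    (fun r _ => hasDerivAt_radialCutoff_sq k r) (hM'.intervalIntegrable _ _)
    ((by fun_prop : Continuous fun r : ℝ =>
      deriv (radialCutoff k) (r ^ 2) * (2 * r)).intervalIntegrable _ _)]
  simp [radialCutoff_of_one_le k le_rfl, radialCutoff_zero]

/-- After integration by parts the cutoff appears undifferentiated, and dominated convergence
applies. -/
theorem tendsto_integral_mul_deriv_radialCutoff {M M' : ℝ → ℝ} (hM : ∀ r, HasDerivAt M (M' r) r)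
    (hM' : Continuous M') :
    Tendsto (fun k : ℕ => ∫ r in (0 : ℝ)..1, M r * (deriv (radialCutoff k) (r ^ 2) * (2 * r))) atTop
      (𝓝 (-M 1)) := by
  simp only [integral_mul_deriv_radialCutoff hM hM']
  have h1 : Tendsto (fun k : ℕ => ∫ r in (0 : ℝ)..1, M' r * radialCutoff k (r ^ 2)) atTop
      (𝓝 (∫ r in (0 : ℝ)..1, M' r)) := by
    refine intervalIntegral.tendsto_integral_filter_of_dominated_convergence (fun r => |M' r|)
      (Eventually.of_forall fun k => ?_) (Eventually.of_forall fun k => ?_)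
      (hM'.abs.intervalIntegrable _ _) ?_
    · have := (contDiff_radialCutoff k).continuous
      exact (by fun_prop : Continuous fun r => M' r * radialCutoff k (r ^ 2)).aestronglyMeasurable
    · refine Eventually.of_forall fun r _ => ?_
      rw [norm_mul, Real.norm_eq_abs, Real.norm_of_nonneg (radialCutoff_nonneg _ _)]
      exact mul_le_of_le_one_right (abs_nonneg _) (radialCutoff_le_one _ _)
    · have h1 : ∀ᵐ r : ℝ, r ≠ 1 := by simp [ae_iff]
      filter_upwards [h1] with r hr1 hr
      rw [uIoc_of_le zero_le_one] at hr
      have : r < 1 := lt_of_le_of_ne hr.2 hr1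
      simpa using (tendsto_radialCutoff (ρ := r ^ 2) (by nlinarith [hr.1])).const_mul (M' r)
  have h2 : ∫ r in (0 : ℝ)..1, M' r = M 1 - M 0 :=
    intervalIntegral.integral_eq_sub_of_hasDerivAt (fun r _ => hM r) (hM'.intervalIntegrable _ _)
  rw [h2] at h1
  have h3 := h1.const_sub (-M 0)
  rwa [show -M 0 - (M 1 - M 0) = -M 1 by ring] at h3

/-- The bound does not depend on k, although the derivatives of the cutoffs are unbounded in k. It
provides the dominating constant on the sphere. -/
theorem norm_integral_mul_deriv_radialCutoff_le {M M' : ℝ → ℝ}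
    (hM : ∀ r, HasDerivAt M (M' r) r) (hM' : Continuous M') {K K' : ℝ} (hK : |M 0| ≤ K)
    (hK' : ∀ r ∈ Icc (0 : ℝ) 1, |M' r| ≤ K') (k : ℕ) :
    ‖∫ r in (0 : ℝ)..1, M r * (deriv (radialCutoff k) (r ^ 2) * (2 * r))‖ ≤ K + K' := by
  rw [integral_mul_deriv_radialCutoff hM hM']
  refine (norm_sub_le _ _).trans (add_le_add (by simpa using hK) ?_)
  have := intervalIntegral.norm_integral_le_of_norm_le_const (a := 0) (b := 1) (C := K')
    (f := fun r => M' r * radialCutoff k (r ^ 2)) (fun r hr => ?_)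
  · simpa using this
  · rw [uIoc_of_le zero_le_one] at hr
    rw [norm_mul, Real.norm_eq_abs, Real.norm_of_nonneg (radialCutoff_nonneg _ _)]
    exact (mul_le_of_le_one_right (abs_nonneg _) (radialCutoff_le_one _ _)).trans
      (hK' r ⟨hr.1.le, hr.2⟩)

theorem fderiv_radialCutoff_norm_sq {E : Type*} [NormedAddCommGroup E] [InnerProductSpace ℝ E]
    (k : ℕ) (w u : E) :
    fderiv ℝ (fun w : E => radialCutoff k (‖w‖ ^ 2)) w u =
      deriv (radialCutoff k) (‖w‖ ^ 2) * (2 * inner ℝ w u) := by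
  have h1 : HasDerivAt (radialCutoff k) (deriv (radialCutoff k) (‖w‖ ^ 2)) (‖w‖ ^ 2) :=
    ((contDiff_radialCutoff k).differentiable (by norm_num)).differentiableAt.hasDerivAt
  have h2 : HasFDerivAt (fun w : E => ‖w‖ ^ 2) _ w := (hasFDerivAt_id w).norm_sq
  have h3 := (h1.comp_hasFDerivAt w h2).fderiv
  rw [Function.comp_def] at h3
  rw [h3]
  simp

section Divergence

variable {E : Type*} [NormedAddCommGroup E] [InnerProductSpace ℝ E] [FiniteDimensional ℝ E]
  [MeasurableSpace E] [BorelSpace E]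

theorem integral_polar {F : E → ℝ} (hF : Integrable F) [Nontrivial E] :
    ∫ w, F w = ∫ z : Metric.sphere (0 : E) 1, (∫ r in Ioi (0 : ℝ),
      r ^ (Module.finrank ℝ E - 1) * F (r • (z : E))) ∂(volume : Measure E).toSphere := by
  set d := Module.finrank ℝ E - 1 with hd
  have hmp := (volume : Measure E).measurePreserving_homeomorphUnitSphereProd
  have hemb := (homeomorphUnitSphereProd E).measurableEmbedding
  have hfun : ∀ x : ({0}ᶜ : Set E), F (((homeomorphUnitSphereProd E x).2 : ℝ) •
      ((homeomorphUnitSphereProd E x).1 : E)) = F x := by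
    intro x
    have hx : ‖(x : E)‖ ≠ 0 := norm_ne_zero_iff.2 x.2
    simp [smul_smul, hx]
  have hcomp : ∫ w, F w = ∫ p : Metric.sphere (0 : E) 1 × Ioi (0 : ℝ), F ((p.2 : ℝ) • (p.1 : E))
      ∂(volume : Measure E).toSphere.prod (.volumeIoiPow d) := by
    rw [← hmp.integral_comp hemb]
    simp only [hfun]
    rw [integral_subtype_comap (measurableSet_singleton _).compl fun x => F x,
      restrict_compl_singleton]
  have hint : Integrable (fun p : Metric.sphere (0 : E) 1 × Ioi (0 : ℝ) =>
      F ((p.2 : ℝ) • (p.1 : E))) ((volume : Measure E).toSphere.prod (.volumeIoiPow d)) := by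
    rw [← hmp.integrable_comp_emb hemb]
    have h1 : ((fun p : Metric.sphere (0 : E) 1 × Ioi (0 : ℝ) => F ((p.2 : ℝ) • (p.1 : E))) ∘
        homeomorphUnitSphereProd E) = F ∘ Subtype.val := funext hfun
    rw [h1, ← integrableOn_iff_comap_subtypeVal (measurableSet_singleton _).compl]
    exact hF.integrableOn
  rw [hcomp, integral_prod _ hint]
  refine integral_congr_ae (Eventually.of_forall fun z => ?_)
  simp only [Measure.volumeIoiPow, ENNReal.ofReal]
  rw [integral_withDensity_eq_integral_smul
      ((measurable_subtype_coe.pow_const _).real_toNNReal),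
    integral_subtype_comap measurableSet_Ioi
      fun a : ℝ => Real.toNNReal (a ^ d) • F (a • (z : E))]
  refine setIntegral_congr_fun measurableSet_Ioi fun r hr => ?_
  simp only [NNReal.smul_def, Real.coe_toNNReal _ (pow_nonneg (le_of_lt hr) _), smul_eq_mul]

/-- Pair G with the derivatives of smooth radial cutoffs of the ball. Integration by parts on the
whole space turns the pairing into minus the integral of ∂_u G against the cutoff, which tends to
the ball integral. In polar coordinates the same pairing concentrates on the sphere. The two limits
agree. -/
theorem integral_sphere_mul_inner_of_contDiff [Nontrivial E] {G : E → ℝ} (hG : ContDiff ℝ 1 G)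
    (hGs : HasCompactSupport G) (u : E) :
    ∫ z : Metric.sphere (0 : E) 1, G z * inner ℝ (z : E) u ∂(volume : Measure E).toSphere =
      ∫ w in Metric.ball (0 : E) 1, fderiv ℝ G w u := by
  have hGc := hG.continuous
  have hG'c : Continuous fun w => fderiv ℝ G w := hG.continuous_fderiv (by norm_num)
  have hG's : HasCompactSupport fun w => fderiv ℝ G w u := by
    have := hGs.fderiv_apply (𝕜 := ℝ) u
    exact this
  obtain ⟨C₀, hC₀⟩ := hGs.exists_bound_of_continuous hGc
  obtain ⟨C₁, hC₁⟩ := (hGs.fderiv (𝕜 := ℝ)).exists_bound_of_continuous hG'c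
  have hC₀' : 0 ≤ C₀ := (norm_nonneg _).trans (hC₀ 0)
  have hC₁' : 0 ≤ C₁ := (norm_nonneg _).trans (hC₁ 0)
  set d := Module.finrank ℝ E - 1 with hd
  -- integration by parts
  set φ : ℕ → E → ℝ := fun k w => radialCutoff k (‖w‖ ^ 2) with hφ
  have hφd : ∀ k, ContDiff ℝ 1 (φ k) := fun k =>
    (contDiff_radialCutoff k).comp (contDiff_norm_sq ℝ)
  have hφ'c : ∀ k, Continuous fun w => fderiv ℝ (φ k) w u := fun k =>
    ((hφd k).continuous_fderiv (by norm_num)).clm_apply continuous_const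
  have hint : ∀ k, Integrable fun w => G w * fderiv ℝ (φ k) w u := fun k =>
    (hGc.mul (hφ'c k)).integrable_of_hasCompactSupport hGs.mul_right
  have hparts : ∀ k, ∫ w, G w * fderiv ℝ (φ k) w u = -∫ w, fderiv ℝ G w u * φ k w := fun k => by
    refine integral_mul_fderiv_eq_neg_fderiv_mul_of_integrable (𝕜 := ℝ) ?_ (hint k) ?_
      (fun x _ => hG.differentiable (by norm_num) x)
      (fun x _ => (hφd k).differentiable (by norm_num) x)
    · exact ((hG'c.clm_apply continuous_const).mul
        (hφd k).continuous).integrable_of_hasCompactSupport hG's.mul_right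
    · exact (hGc.mul (hφd k).continuous).integrable_of_hasCompactSupport hGs.mul_right
  -- the volume side
  have hvol : Tendsto (fun k => ∫ w, fderiv ℝ G w u * φ k w) atTop
      (𝓝 (∫ w in Metric.ball (0 : E) 1, fderiv ℝ G w u)) := by
    rw [← integral_indicator Metric.isOpen_ball.measurableSet]
    refine tendsto_integral_of_dominated_convergence (fun w => ‖fderiv ℝ G w u‖) (fun k => ?_)
      ?_ (fun k => ?_) ?_
    · exact ((hG'c.clm_apply continuous_const).mul (hφd k).continuous).aestronglyMeasurable
    · exact ((hG'c.clm_apply continuous_const).integrable_of_hasCompactSupport hG's).norm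
    · refine Eventually.of_forall fun w => ?_
      rw [norm_mul, Real.norm_of_nonneg (radialCutoff_nonneg _ _)]
      exact mul_le_of_le_one_right (norm_nonneg _) (radialCutoff_le_one _ _)
    · refine Eventually.of_forall fun w => ?_
      by_cases hw : w ∈ Metric.ball (0 : E) 1
      · rw [indicator_of_mem hw]
        rw [mem_ball_zero_iff] at hw
        simpa using (tendsto_radialCutoff (ρ := ‖w‖ ^ 2)
          (by nlinarith [norm_nonneg w])).const_mul (fderiv ℝ G w u)
      · rw [indicator_of_notMem hw]
        rw [mem_ball_zero_iff, not_lt] at hw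
        refine tendsto_const_nhds.congr fun k => ?_
        simp only [hφ]
        rw [radialCutoff_of_one_le k (by nlinarith), mul_zero]
  -- the sphere side
  set M : E → ℝ → ℝ := fun z r => r ^ d * G (r • z) with hM
  -- In dimension one d = 0; the truncated exponent d - 1 is harmless since its coefficient
  -- vanishes.
  set M' : E → ℝ → ℝ := fun z r =>
    (d : ℝ) * r ^ (d - 1) * G (r • z) + r ^ d * fderiv ℝ G (r • z) z with hM'
  have hMd : ∀ z r, HasDerivAt (M z) (M' z r) r := by
    intro z r
    have h1 : HasDerivAt (fun r : ℝ => r • z) z r := by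
      simpa using (hasDerivAt_id r).smul_const z
    exact (hasDerivAt_pow d r).mul
      ((hG.differentiable (by norm_num) (r • z)).hasFDerivAt.comp_hasDerivAt r h1)
  have hM'c : ∀ z, Continuous (M' z) := fun z => by
    have : Continuous fun r : ℝ => fderiv ℝ G (r • z) z :=
      (hG'c.comp (by fun_prop : Continuous fun r : ℝ => r • z)).clm_apply continuous_const
    fun_prop
  have hpolar : ∀ k, ∫ w, G w * fderiv ℝ (φ k) w u = ∫ z : Metric.sphere (0 : E) 1,
      (∫ r in (0 : ℝ)..1, M z r * (deriv (radialCutoff k) (r ^ 2) * (2 * r))) * inner ℝ (z : E) u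
        ∂(volume : Measure E).toSphere := by
    intro k
    rw [integral_polar (hint k)]
    refine integral_congr_ae (Eventually.of_forall fun z => ?_)
    simp only
    have hz : ‖(z : E)‖ = 1 := by simp
    rw [intervalIntegral.integral_of_le zero_le_one, ← integral_mul_const]
    have hpt : ∀ r : ℝ, r ^ d * (G (r • (z : E)) * fderiv ℝ (φ k) (r • (z : E)) u) =
        M z r * (deriv (radialCutoff k) (r ^ 2) * (2 * r)) * inner ℝ (z : E) u := by
      intro r
      simp only [hφ]
      rw [fderiv_radialCutoff_norm_sq, norm_smul, hz, mul_one, Real.norm_eq_abs, sq_abs,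
        real_inner_smul_left]
      ring
    simp only [← hd, hpt]
    refine setIntegral_eq_of_subset_of_forall_sdiff_eq_zero measurableSet_Ioi
      Ioc_subset_Ioi_self fun r hr => ?_
    have hr1 : 1 < r := by
      by_contra! h
      exact hr.2 ⟨hr.1, h⟩
    rw [deriv_radialCutoff_of_one_lt k (by nlinarith)]
    ring
  have hsph : Tendsto (fun k => ∫ w, G w * fderiv ℝ (φ k) w u) atTop
      (𝓝 (∫ z : Metric.sphere (0 : E) 1, -(G z) * inner ℝ (z : E) u
        ∂(volume : Measure E).toSphere)) := by
    simp only [hpolar]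
    refine tendsto_integral_of_dominated_convergence
      (fun z => (C₀ + (d * C₀ + C₁)) * ‖u‖) (fun k => ?_) (integrable_const _) (fun k => ?_) ?_
    · refine Continuous.aestronglyMeasurable ?_
      have hc := continuous_deriv_radialCutoff k
      have : Continuous fun z : E =>
          ∫ r in (0 : ℝ)..1, M z r * (deriv (radialCutoff k) (r ^ 2) * (2 * r)) := by
        refine intervalIntegral.continuous_parametric_intervalIntegral_of_continuous' ?_ _ _
        simp only [hM, Function.uncurry_def]
        fun_prop
      exact (this.comp continuous_subtype_val).mul
        (continuous_subtype_val.inner continuous_const)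
    · refine Eventually.of_forall fun z => ?_
      have hz : ‖(z : E)‖ = 1 := by simp
      rw [norm_mul]
      refine mul_le_mul (norm_integral_mul_deriv_radialCutoff_le (hMd z) (hM'c z) ?_ ?_ k) ?_
        (norm_nonneg _) (by positivity)
      · simp only [hM, abs_mul, abs_pow, abs_zero]
        exact (mul_le_of_le_one_left (abs_nonneg _)
          (pow_le_one₀ le_rfl zero_le_one)).trans (hC₀ _)
      · intro r hr
        have hp : ∀ m : ℕ, |r ^ m| ≤ 1 := fun m => by
          rw [abs_of_nonneg (pow_nonneg hr.1 m)]
          exact pow_le_one₀ hr.1 hr.2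
        refine (abs_add_le _ _).trans (add_le_add ?_ ?_)
        · rw [abs_mul, abs_mul, Nat.abs_cast, mul_assoc]
          gcongr
          exact (mul_le_of_le_one_left (abs_nonneg _) (hp _)).trans (hC₀ _)
        · rw [abs_mul]
          refine (mul_le_of_le_one_left (abs_nonneg _) (hp _)).trans ?_
          have := (fderiv ℝ G (r • (z : E))).le_of_opNorm_le (hC₁ _) (z : E)
          rwa [hz, mul_one] at this
      · have := norm_inner_le_norm (𝕜 := ℝ) (z : E) u
        rwa [hz, one_mul] at this
    · refine Eventually.of_forall fun z => ?_
      have := (tendsto_integral_mul_deriv_radialCutoff (hMd z) (hM'c z)).mul_const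
        (inner ℝ (z : E) u)
      simpa [hM] using this
  have h1 := tendsto_nhds_unique hsph (by simpa only [hparts] using hvol.neg)
  simp only [neg_mul, integral_neg, neg_inj] at h1
  exact h1

/-- Multiplication by a bump function that is 1 near the closed ball and supported in U reduces to
the compactly supported case. -/
theorem integral_sphere_mul_inner [Nontrivial E] {g : E → ℝ} {U : Set E} (hU : IsOpen U)
    (hBU : Metric.closedBall (0 : E) 1 ⊆ U) (hg : ContDiffOn ℝ 1 g U) (u : E) :
    ∫ z : Metric.sphere (0 : E) 1, g z * inner ℝ (z : E) u ∂(volume : Measure E).toSphere =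
      ∫ w in Metric.ball (0 : E) 1, fderiv ℝ g w u := by
  obtain ⟨δ, hδ, hδU⟩ := (isCompact_closedBall (0 : E) 1).exists_cthickening_subset_open hU hBU
  rw [cthickening_closedBall hδ.le zero_le_one] at hδU
  let χ : ContDiffBump (0 : E) := ⟨1 + δ / 2, δ + 1, by linarith, by linarith⟩
  have hχ1 : ∀ w ∈ Metric.ball (0 : E) (1 + δ / 2), χ w = 1 := fun w hw =>
    χ.one_of_mem_closedBall (Metric.ball_subset_closedBall hw)
  have hG : ContDiff ℝ 1 fun w => χ w * g w := by
    refine contDiff_iff_contDiffAt.2 fun w => ?_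
    by_cases hw : w ∈ U
    · exact χ.contDiff.contDiffAt.mul (hg.contDiffAt (hU.mem_nhds hw))
    · have hw' : w ∉ tsupport χ := fun h => hw (hδU (by rwa [χ.tsupport_eq] at h))
      have : (fun w => χ w * g w) =ᶠ[𝓝 w] fun _ => 0 := by
        filter_upwards [notMem_tsupport_iff_eventuallyEq.1 hw'] with y hy
        simp [hy]
      exact contDiffAt_const.congr_of_eventuallyEq this
  have hGs : HasCompactSupport fun w => χ w * g w := χ.hasCompactSupport.mul_right
  have h := integral_sphere_mul_inner_of_contDiff hG hGs u
  have hsub : Metric.closedBall (0 : E) 1 ⊆ Metric.ball (0 : E) (1 + δ / 2) :=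
    Metric.closedBall_subset_ball (by linarith)
  have e1 : ∀ z : Metric.sphere (0 : E) 1, χ z * g z * inner ℝ (z : E) u =
      g z * inner ℝ (z : E) u := fun z => by
    rw [hχ1 _ (hsub (Metric.sphere_subset_closedBall z.2)), one_mul]
  have e2 : ∀ w ∈ Metric.ball (0 : E) 1, fderiv ℝ (fun w => χ w * g w) w u = fderiv ℝ g w u := by
    intro w hw
    have : (fun w => χ w * g w) =ᶠ[𝓝 w] g := by
      filter_upwards [Metric.isOpen_ball.mem_nhds (hsub (Metric.ball_subset_closedBall hw))] with y hy
      rw [hχ1 y hy, one_mul]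
    rw [this.fderiv_eq]
  rw [setIntegral_congr_fun Metric.isOpen_ball.measurableSet e2] at h
  simpa only [e1] using h

end Divergence

end

section

variable {n : ℕ} {ν : ℝ} {X : Set (Eucl n)} {R : Eucl n → ℝ}

/-! ### Rewards -/

namespace IsReward

variable {β L : ℝ} {ℓ : ℝ≥0} {f : Eucl n → ℝ}

theorem continuousOn (hf : IsReward X β L ℓ f) : ContinuousOn f X := by
  obtain ⟨G, hG⟩ := hf.lipschitz
  exact hG.continuousOn

theorem hasGradientAt (hf : IsReward X β L ℓ f) {x : Eucl n} (hx : x ∈ interior X) :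
    HasGradientAt f (∇ f x) x :=
  hf.differentiableOn.hasGradientAt (isOpen_interior.mem_nhds hx)

theorem contDiffOn (hf : IsReward X β L ℓ f) : ContDiffOn ℝ 1 f (interior X) := by
  refine (contDiffOn_succ_iff_fderiv_of_isOpen (n := 0) isOpen_interior).2
    ⟨hf.differentiableOn, by simp, contDiffOn_zero.2 ?_⟩
  have := (InnerProductSpace.toDual ℝ (Eucl n)).continuous.comp_continuousOn
    hf.smooth.continuousOn
  rwa [toDual_comp_gradient] at this

/-- Divide strong concavity on the segment from y to p by s and let s → 0. Only y has to be
interior. -/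
theorem le_tangent (hf : IsReward X β L ℓ f) {y p : Eucl n} (hy : y ∈ interior X) (hp : p ∈ X) :
    f p ≤ f y + inner ℝ (∇ f y) (p - y) - β / 2 * ‖p - y‖ ^ 2 := by
  have hd : HasDerivAt (fun s : ℝ => f (y + s • (p - y))) (inner ℝ (∇ f y) (p - y)) 0 := by
    have h1 : HasDerivAt (fun s : ℝ => y + s • (p - y)) (p - y) 0 := by
      simpa using ((hasDerivAt_id (0 : ℝ)).smul_const (p - y)).const_add y
    exact (by simpa using hf.hasGradientAt hy :
      HasGradientAt f (∇ f y) (y + (0 : ℝ) • (p - y))).hasFDerivAt.comp_hasDerivAt 0 h1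
  have hlim : Tendsto (fun s : ℝ => s⁻¹ • (f (y + s • (p - y)) - f y)) (𝓝[>] 0)
      (𝓝 (inner ℝ (∇ f y) (p - y))) := by
    simpa using hd.tendsto_slope_zero_right
  have hlim2 : Tendsto (fun s : ℝ => f p - f y + (1 - s) * (β / 2 * ‖p - y‖ ^ 2)) (𝓝[>] 0)
      (𝓝 (f p - f y + (1 - 0) * (β / 2 * ‖p - y‖ ^ 2))) :=
    (Continuous.tendsto (by fun_prop) 0).mono_left nhdsWithin_le_nhds
  have := le_of_tendsto_of_tendsto hlim2 hlim ?_
  · rw [sub_zero, one_mul] at this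
    linarith
  filter_upwards [Ioo_mem_nhdsGT (zero_lt_one (α := ℝ))] with s hs
  have h := hf.strongConcaveOn.2 hp (interior_subset hy) hs.1.le (by linarith [hs.2] : 0 ≤ 1 - s)
    (by ring)
  have e : s • p + (1 - s) • y = y + s • (p - y) := by module
  rw [e] at h
  simp only [smul_eq_mul] at h
  rw [smul_eq_mul, inv_mul_eq_div, le_div_iff₀ hs.1]
  nlinarith

/-- Strong concavity at the midpoint gives β/8·‖x - y‖² ≤ 2L. This bounds X, which is only assumed
closed. -/
theorem norm_sub_sq_le (hf : IsReward X β L ℓ f) (hβ : 0 < β) {x y : Eucl n} (hx : x ∈ X)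
    (hy : y ∈ X) : ‖x - y‖ ^ 2 ≤ 16 * L / β := by
  have h := hf.strongConcaveOn.2 hx hy (by norm_num : (0 : ℝ) ≤ 1 / 2)
    (by norm_num : (0 : ℝ) ≤ 1 / 2) (by norm_num)
  have hm := hf.bounded _ (hf.strongConcaveOn.1 hx hy (by norm_num : (0 : ℝ) ≤ 1 / 2)
    (by norm_num : (0 : ℝ) ≤ 1 / 2) (by norm_num))
  have h1 := abs_le.1 (hf.bounded x hx)
  have h2 := abs_le.1 (hf.bounded y hy)
  have h3 := (abs_le.1 hm).2
  simp only [smul_eq_mul] at h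
  rw [le_div_iff₀ hβ]
  linarith [h1.1, h2.1]

theorem isCompact (hf : IsReward X β L ℓ f) (hβ : 0 < β) (hX : IsClosed X) : IsCompact X := by
  refine Metric.isCompact_of_isClosed_isBounded hX (Metric.isBounded_iff.2
    ⟨√(16 * L / β), fun x hx y hy => ?_⟩)
  rw [dist_eq_norm]
  exact Real.le_sqrt_of_sq_le (hf.norm_sub_sq_le hβ hx hy)

theorem abs_inner_gradient_sub_le (hf : IsReward X β L ℓ f) {x y : Eucl n}
    (hx : x ∈ interior X) (hy : y ∈ interior X) :
    |inner ℝ (∇ f y - ∇ f x) (y - x)| ≤ ℓ * ‖y - x‖ ^ 2 := by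
  have h1 := abs_real_inner_le_norm (∇ f y - ∇ f x) (y - x)
  have h2 := hf.smooth.norm_sub_le hy hx
  nlinarith [norm_nonneg (y - x)]

/-- Add the tangent inequalities from y to p and from x to y, and expand ‖p - y‖² around x. The
quadratic gain is then located at the pivot x, and the remaining cross term is linear in y - x, so
it averages to zero over the ellipsoid. -/
theorem sub_le_inner_gradient (hf : IsReward X β L ℓ f) (hβ : 0 ≤ β) {x y p : Eucl n}
    (hx : x ∈ interior X) (hy : y ∈ interior X) (hp : p ∈ X) :
    f p - f x + β / 2 * ‖p - x‖ ^ 2 - ℓ * ‖y - x‖ ^ 2 - β * inner ℝ (p - x) (y - x) ≤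
      inner ℝ (∇ f y) (p - x) := by
  have h1 := hf.le_tangent hy hp
  have h2 := hf.le_tangent hx (interior_subset hy)
  have h3 := neg_le_of_abs_le (hf.abs_inner_gradient_sub_le hx hy)
  have e1 : p - y = (p - x) - (y - x) := by abel
  rw [e1, norm_sub_sq_real, inner_sub_right] at h1
  rw [inner_sub_left] at h3
  nlinarith [sq_nonneg ‖y - x‖]

theorem tangent_sub_le (hf : IsReward X β L ℓ f) (hβ : 0 ≤ β) {x y : Eucl n}
    (hx : x ∈ interior X) (hy : y ∈ interior X) :
    f x + inner ℝ (∇ f x) (y - x) - ℓ * ‖y - x‖ ^ 2 ≤ f y := by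
  have h1 := hf.le_tangent hy (interior_subset hx)
  have h3 := neg_le_of_abs_le (hf.abs_inner_gradient_sub_le hx hy)
  have e1 : x - y = -(y - x) := by abel
  rw [e1, inner_neg_right] at h1
  rw [inner_sub_left] at h3
  nlinarith [mul_nonneg hβ (sq_nonneg ‖-(y - x)‖)]

end IsReward

/-! ### Means over the sphere -/

section Sphere

theorem toSphere_real_univ (n : ℕ) : (volume : Measure (Eucl n)).toSphere.real univ =
    n * (volume : Measure (Eucl n)).real (Metric.ball 0 1) := by
  rw [Measure.toSphere_real_apply_univ, finrank_euclideanSpace_fin]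

theorem volume_ball_pos (n : ℕ) : 0 < (volume : Measure (Eucl n)).real (Metric.ball 0 1) :=
  ENNReal.toReal_pos (Metric.measure_ball_pos _ _ one_pos).ne' measure_ball_lt_top.ne

/-- The sphere has n times the volume of the ball as its area; this absorbs the factor n of the
estimator. -/
theorem integral_sphereUniform (hn : 1 ≤ n) (F : Metric.sphere (0 : Eucl n) 1 → ℝ) :
    n * ∫ z, F z ∂(sphereUniform n) =
      ((volume : Measure (Eucl n)).real (Metric.ball 0 1))⁻¹ *
        ∫ z, F z ∂(volume : Measure (Eucl n)).toSphere := by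
  have hn' : (n : ℝ) ≠ 0 := by positivity
  rw [sphereUniform, integral_smul_measure, ENNReal.toReal_inv, ← measureReal_def,
    toSphere_real_univ, smul_eq_mul, mul_inv]
  field_simp

theorem isProbabilityMeasure_sphereUniform (hn : 1 ≤ n) :
    IsProbabilityMeasure (sphereUniform n) := by
  have : Nonempty (Fin n) := ⟨⟨0, hn⟩⟩
  refine ⟨?_⟩
  rw [sphereUniform, Measure.smul_apply, smul_eq_mul]
  refine ENNReal.inv_mul_cancel ?_ (measure_ne_top _ _)
  rw [Ne, Measure.measure_univ_eq_zero]
  exact Measure.toSphere_ne_zero _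

/-- The divergence theorem for a constant function. -/
theorem integral_inner_sphereUniform (hn : 1 ≤ n) (u : Eucl n) :
    ∫ z, inner ℝ (z : Eucl n) u ∂(sphereUniform n) = 0 := by
  have : Nonempty (Fin n) := ⟨⟨0, hn⟩⟩
  have h1 := integral_sphereUniform hn fun z => inner ℝ (z : Eucl n) u
  have h2 := integral_sphere_mul_inner (g := fun _ : Eucl n => (1 : ℝ)) isOpen_univ
    (subset_univ _) contDiffOn_const u
  simp only [one_mul, fderiv_fun_const, Pi.zero_apply, zero_apply,
    integral_zero] at h2
  rw [h2, mul_zero] at h1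
  have hn' : (n : ℝ) ≠ 0 := by positivity
  simpa [hn'] using h1

theorem setIntegral_ball_linear (Λ : Eucl n →L[ℝ] ℝ) :
    ∫ w in Metric.ball (0 : Eucl n) 1, Λ w = 0 := by
  have h : ∫ w, (Metric.ball (0 : Eucl n) 1).indicator Λ (-w) =
      -∫ w, (Metric.ball (0 : Eucl n) 1).indicator Λ w := by
    rw [← integral_neg]
    refine integral_congr_ae (Eventually.of_forall fun w => ?_)
    by_cases hw : w ∈ Metric.ball (0 : Eucl n) 1
    · have hw' : -w ∈ Metric.ball (0 : Eucl n) 1 := by simpa using hw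
      simp only [indicator_of_mem hw, indicator_of_mem hw', map_neg]
    · have hw' : -w ∉ Metric.ball (0 : Eucl n) 1 := by simpa using hw
      simp only [indicator_of_notMem hw, indicator_of_notMem hw', neg_zero]
  rw [integral_neg_eq_self (fun w => (Metric.ball (0 : Eucl n) 1).indicator Λ w)] at h
  rw [← integral_indicator Metric.isOpen_ball.measurableSet]
  linarith

end Sphere

/-! ### Conditional expectations in one round -/

section Round

variable {β η L : ℝ} {ℓ : ℝ≥0} {f : Eucl n → ℝ} {t : ℕ} {x : Eucl n}

theorem inner_gradEst (R : Eucl n → ℝ) (β η : ℝ) (t : ℕ) (f : Eucl n → ℝ) (x z v : Eucl n) :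
    inner ℝ (gradEst R β t f x z η) v = n * (f (play R β t x z η) *
      inner ℝ z (Matrix.toEuclideanCLM (𝕜 := ℝ) (scaling R β t x η)⁻¹ v)) := by
  rw [gradEst, real_inner_smul_left, inner_toEuclideanCLM_comm
    (IsSelfConcordantBarrier.isHermitian_scaling_inv R β η t x), mul_assoc]

/-- The single-shot estimator is unbiased for the gradient averaged over the ellipsoid. -/
theorem integral_inner_gradEst (hn : 1 ≤ n) (hR : IsSelfConcordantBarrier ν X R)
    (hc : 0 < η * β * ((t : ℝ) + 1)) (hf : IsReward X β L ℓ f) (hx : x ∈ interior X)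
    (v : Eucl n) :
    ∫ z, inner ℝ (gradEst R β t f x z η) v ∂(sphereUniform n) =
      ((volume : Measure (Eucl n)).real (Metric.ball 0 1))⁻¹ *
        ∫ w in Metric.ball (0 : Eucl n) 1, inner ℝ (∇ f (play R β t x w η)) v := by
  have : Nonempty (Fin n) := ⟨⟨0, hn⟩⟩
  simp only [inner_gradEst]
  rw [integral_const_mul, integral_sphereUniform hn]
  congr 1
  have hplay : ContDiff ℝ 1 fun w => play R β t x w η := by
    unfold play
    fun_prop
  rw [integral_sphere_mul_inner (U := (fun w => play R β t x w η) ⁻¹' interior X)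
    (g := fun w => f (play R β t x w η)) (isOpen_interior.preimage hplay.continuous)
    (fun w hw => hR.play_mem_interior hc hx (by simpa using hw))
    (hf.contDiffOn.comp hplay.contDiffOn fun w hw => hw)]
  refine setIntegral_congr_fun Metric.isOpen_ball.measurableSet fun w hw => ?_
  have hw' : ‖w‖ ≤ 1 := by
    rw [mem_ball_zero_iff] at hw
    exact hw.le
  have h1 : HasFDerivAt (fun w => play R β t x w η)
      (Matrix.toEuclideanCLM (𝕜 := ℝ) (scaling R β t x η)) w :=
    (ContinuousLinearMap.hasFDerivAt _).const_add x
  have h2 := ((hf.hasGradientAt (hR.play_mem_interior hc hx hw')).hasFDerivAt.comp w h1).fderiv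
  rw [Function.comp_def] at h2
  rw [h2]
  simp only [ContinuousLinearMap.comp_apply, InnerProductSpace.toDual_apply_apply]
  -- The chain rule brings out the scaling, which cancels the inverse scaling built into the
  -- estimator.
  rw [hR.scaling_apply_inv hc hx]

theorem le_integral_inner_gradEst (hn : 1 ≤ n) (hR : IsSelfConcordantBarrier ν X R)
    (hβ : 0 ≤ β) (hc : 0 < η * β * ((t : ℝ) + 1)) (hf : IsReward X β L ℓ f) (hx : x ∈ interior X)
    {p : Eucl n} (hp : p ∈ X) :
    f p - f x + β / 2 * ‖p - x‖ ^ 2 - ℓ / (η * β * ((t : ℝ) + 1)) ≤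
      ∫ z, inner ℝ (gradEst R β t f x z η) (p - x) ∂(sphereUniform n) := by
  rw [integral_inner_gradEst hn hR hc hf hx]
  set K := f p - f x + β / 2 * ‖p - x‖ ^ 2 - ℓ / (η * β * ((t : ℝ) + 1)) with hK
  set Λ : Eucl n →L[ℝ] ℝ := β • (innerSL ℝ (p - x)).comp
    (Matrix.toEuclideanCLM (𝕜 := ℝ) (scaling R β t x η)) with hΛ
  have hV := volume_ball_pos n
  have hplay : Continuous fun w => play R β t x w η := by
    unfold play
    fun_prop
  have hint : IntegrableOn (fun w => inner ℝ (∇ f (play R β t x w η)) (p - x))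
      (Metric.ball (0 : Eucl n) 1) := by
    have hc : ContinuousOn (fun w => inner ℝ (∇ f (play R β t x w η)) (p - x))
        (Metric.closedBall (0 : Eucl n) 1) :=
      (hf.smooth.continuousOn.comp hplay.continuousOn fun w hw =>
        hR.play_mem_interior hc hx (by simpa using hw)).inner continuousOn_const
    exact (hc.integrableOn_compact (isCompact_closedBall _ _)).mono_set Metric.ball_subset_closedBall
  have hΛint : IntegrableOn Λ (Metric.ball (0 : Eucl n) 1) :=
    (Λ.continuous.continuousOn.integrableOn_compact (isCompact_closedBall (0 : Eucl n) 1)).mono_set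
      Metric.ball_subset_closedBall
  have hKint : IntegrableOn (fun _ => K) (Metric.ball (0 : Eucl n) 1) :=
    integrableOn_const measure_ball_lt_top.ne
  have hle : ∫ w in Metric.ball (0 : Eucl n) 1, (K - Λ w) ≤
      ∫ w in Metric.ball (0 : Eucl n) 1, inner ℝ (∇ f (play R β t x w η)) (p - x) := by
    refine setIntegral_mono_on (hKint.sub hΛint) hint Metric.isOpen_ball.measurableSet
      fun w hw => ?_
    have hw' : ‖w‖ ≤ 1 := by
      rw [mem_ball_zero_iff] at hw
      exact hw.le
    have h1 := hf.sub_le_inner_gradient hβ hx (hR.play_mem_interior hc hx hw') hp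
    have h2 := hR.norm_scaling_sq_le hc hx hw'
    have e : play R β t x w η - x = Matrix.toEuclideanCLM (𝕜 := ℝ) (scaling R β t x η) w := by
      rw [play, add_sub_cancel_left]
    rw [e] at h1
    have h3 : (ℓ : ℝ) * ‖Matrix.toEuclideanCLM (𝕜 := ℝ) (scaling R β t x η) w‖ ^ 2 ≤
        ℓ / (η * β * ((t : ℝ) + 1)) := by
      rw [← mul_one_div]
      gcongr
    have e2 : Λ w = β * inner ℝ (p - x) (Matrix.toEuclideanCLM (𝕜 := ℝ) (scaling R β t x η) w) := by
      rfl
    rw [e2]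
    linarith
  rw [integral_sub hKint hΛint, setIntegral_ball_linear, sub_zero, setIntegral_const,
    smul_eq_mul] at hle
  rw [inv_mul_eq_div, le_div_iff₀ hV]
  linarith

theorem integrable_sphere {F : Metric.sphere (0 : Eucl n) 1 → ℝ} (hF : Continuous F)
    (μ : Measure (Metric.sphere (0 : Eucl n) 1)) [IsFiniteMeasure μ] : Integrable F μ :=
  hF.integrable_of_hasCompactSupport (HasCompactSupport.of_compactSpace F)

/-- Exploration costs only a second-order term, since the linear term has mean zero on the sphere.
-/
theorem le_integral_play (hn : 1 ≤ n) (hR : IsSelfConcordantBarrier ν X R)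
    (hβ : 0 ≤ β) (hc : 0 < η * β * ((t : ℝ) + 1)) (hf : IsReward X β L ℓ f)
    (hx : x ∈ interior X) :
    f x - ℓ / (η * β * ((t : ℝ) + 1)) ≤
      ∫ z : Metric.sphere (0 : Eucl n) 1, f (play R β t x z η) ∂(sphereUniform n) := by
  have := isProbabilityMeasure_sphereUniform hn
  have hz1 : ∀ z : Metric.sphere (0 : Eucl n) 1, ‖(z : Eucl n)‖ ≤ 1 := fun z => by simp
  have hplay : Continuous fun w => play R β t x w η := by
    unfold play
    fun_prop
  have hfc : Continuous fun z : Metric.sphere (0 : Eucl n) 1 => f (play R β t x z η) :=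
    (hf.continuousOn.mono interior_subset).comp_continuous (hplay.comp continuous_subtype_val)
      fun z => hR.play_mem_interior hc hx (hz1 z)
  set u := Matrix.toEuclideanCLM (𝕜 := ℝ) (scaling R β t x η) (∇ f x) with hu
  have hlin : Continuous fun z : Metric.sphere (0 : Eucl n) 1 => inner ℝ (z : Eucl n) u := by
    fun_prop
  have hle : ∫ z : Metric.sphere (0 : Eucl n) 1,
      (f x - ℓ / (η * β * ((t : ℝ) + 1)) + inner ℝ (z : Eucl n) u) ∂(sphereUniform n) ≤
      ∫ z : Metric.sphere (0 : Eucl n) 1, f (play R β t x z η) ∂(sphereUniform n) := by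
    refine integral_mono (integrable_sphere (continuous_const.add hlin) _)
      (integrable_sphere hfc _) fun z => ?_
    have h1 := hf.tangent_sub_le hβ hx (hR.play_mem_interior hc hx (hz1 z))
    have h2 := hR.norm_scaling_sq_le hc hx (hz1 z)
    have e : play R β t x z η - x = Matrix.toEuclideanCLM (𝕜 := ℝ) (scaling R β t x η) z := by
      rw [play, add_sub_cancel_left]
    have h3 : (ℓ : ℝ) * ‖Matrix.toEuclideanCLM (𝕜 := ℝ) (scaling R β t x η) z‖ ^ 2 ≤
        ℓ / (η * β * ((t : ℝ) + 1)) := by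
      rw [← mul_one_div]
      gcongr
    have e2 : inner ℝ (z : Eucl n) u =
        inner ℝ (∇ f x) (Matrix.toEuclideanCLM (𝕜 := ℝ) (scaling R β t x η) (z : Eucl n)) := by
      rw [real_inner_comm, hu]
      exact inner_toEuclideanCLM_comm (isHermitian_cfc _ _) _ _
    rw [e] at h1
    simp only [e2]
    linarith
  rw [integral_add (integrable_const _) (integrable_sphere hlin _),
    integral_inner_sphereUniform hn] at hle
  simpa using hle

end Round

end

section

/-! ### One round of mirror descent -/

/-- Fenchel–Young: applying log u ≤ u - 1 to u = (1 + a)(1 - b) bounds the left side by -b - log(1 -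
b), which is at most 2b² for b ≤ 1/2. -/
theorem mul_sub_sub_log_le {a b : ℝ} (ha : 0 ≤ a) (hb : b ≤ 1 / 2) :
    b * a - (a - Real.log (1 + a)) ≤ 2 * b ^ 2 := by
  have h1 : 0 < 1 - b := by linarith
  have h2 := Real.log_le_sub_one_of_pos (mul_pos (by linarith : 0 < 1 + a) h1)
  rw [Real.log_mul (by linarith) h1.ne'] at h2
  have h3 := Real.one_sub_inv_le_log_of_pos h1
  have h4 : (1 - b)⁻¹ - 1 ≤ b + 2 * b ^ 2 := by
    have : (1 - b)⁻¹ ≤ 1 + b + 2 * b ^ 2 := by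
      rw [inv_le_iff_one_le_mul₀ h1]
      nlinarith [mul_nonneg (sq_nonneg b) (by linarith : 0 ≤ 1 - 2 * b)]
    linarith
  nlinarith

variable {n : ℕ} {ν : ℝ} {X : Set (Eucl n)} {R : Eucl n → ℝ}

theorem inner_gradient_sub_eq_bregman (R : Eucl n → ℝ) (p x x' : Eucl n) :
    inner ℝ (∇ R x' - ∇ R x) (p - x') = bregman R p x - bregman R p x' - bregman R x' x := by
  simp only [bregman, inner_sub_left, inner_sub_right]
  ring

/-- Move the symmetric inverse scaling onto d and use Cauchy–Schwarz: in the dual local norm the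
estimator never exceeds nL, however close x is to the boundary. -/
theorem inner_gradEst_le {β η L : ℝ} {ℓ : ℝ≥0} {f : Eucl n → ℝ} {t : ℕ} {x z : Eucl n}
    (hL : 0 ≤ L) (hR : IsSelfConcordantBarrier ν X R) (hc : 0 < η * β * ((t : ℝ) + 1))
    (hf : IsReward X β L ℓ f) (hx : x ∈ interior X) (hz : ‖z‖ ≤ 1) (d : Eucl n) :
    inner ℝ (gradEst R β t f x z η) d ≤
      n * L * √(inner ℝ d (hess R x d) + η * β * ((t : ℝ) + 1) * ‖d‖ ^ 2) := by
  rw [inner_gradEst, ← hR.norm_scaling_inv_sq hc hx, Real.sqrt_sq (norm_nonneg _), mul_assoc]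
  refine mul_le_mul_of_nonneg_left ((le_abs_self _).trans ?_) (Nat.cast_nonneg n)
  rw [abs_mul]
  refine mul_le_mul (hf.bounded _ (interior_subset (hR.play_mem_interior hc hx hz))) ?_
    (abs_nonneg _) hL
  refine (abs_real_inner_le_norm _ _).trans ?_
  exact mul_le_of_le_one_left (norm_nonneg _) hz

/-- Split p - x at the new pivot x'. The part p - x' is rewritten by the optimality condition and
the three-point identities; the part x' - x is outweighed, up to 2b², by the divergence terms
between x and x'. -/
theorem mirror_step_le {β η L : ℝ} {ℓ : ℝ≥0} {f : Eucl n → ℝ} {t : ℕ} {x z p : Eucl n}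
    (hL : 0 ≤ L) (hη : 0 ≤ η) (hR : IsSelfConcordantBarrier ν X R) (hX : IsCompact X)
    (hc : 0 < η * β * ((t : ℝ) + 1)) (hf : IsReward X β L ℓ f) (hx : x ∈ interior X)
    (hz : ‖z‖ ≤ 1) (hb : η * (n * L) ≤ 1 / 2) :
    η * inner ℝ (gradEst R β t f x z η) (p - x) ≤
      η * β * ((t : ℝ) + 1) / 2 *
        (‖p - x‖ ^ 2 - ‖p - prox X R β t x (gradEst R β t f x z η) η‖ ^ 2) +
      (bregman R p x - bregman R p (prox X R β t x (gradEst R β t f x z η) η)) +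
      2 * (η * (n * L)) ^ 2 := by
  set v := gradEst R β t f x z η with hv
  obtain ⟨h1, h2⟩ := hR.prox_spec hX ⟨x, hx⟩ β t x v η
  set x' := prox X R β t x v η
  set c := η * β * ((t : ℝ) + 1) with hcdef
  have e1 : η * inner ℝ v (p - x) = η * inner ℝ v (p - x') + η * inner ℝ v (x' - x) := by
    rw [← mul_add, ← inner_add_right]; congr 2; abel
  have e2 : η * inner ℝ v (p - x') = c * inner ℝ (x' - x) (p - x') +
      (bregman R p x - bregman R p x' - bregman R x' x) := by
    rw [← inner_gradient_sub_eq_bregman, ← real_inner_smul_left, h2, inner_add_left,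
      real_inner_smul_left]
  have e3 : ‖p - x‖ ^ 2 = ‖p - x'‖ ^ 2 + 2 * inner ℝ (x' - x) (p - x') + ‖x' - x‖ ^ 2 := by
    rw [show p - x = (p - x') + (x' - x) by abel, norm_add_sq_real, real_inner_comm]
  have h3 := inner_gradEst_le hL hR hc hf hx hz (x' - x)
  have h4 := hR.sub_log_le_bregman (d := x' - x) hx (by simpa using h1) hc
  rw [add_sub_cancel] at h4
  rw [← hv, ← hcdef] at h3
  set a := √(inner ℝ (x' - x) (hess R x (x' - x)) + c * ‖x' - x‖ ^ 2)
  have h5 := mul_sub_sub_log_le (Real.sqrt_nonneg _ : 0 ≤ a) hb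
  have h6 := mul_le_mul_of_nonneg_left h3 hη
  nlinarith

/-! ### The pivots along a sequence of directions -/

section Pivot

variable {β L e : ℝ} {ℓ : ℝ≥0} {T : ℕ} {η : ℕ → ℝ} {f : ℕ → Eucl n → ℝ}

theorem pivot_succ (z : ℕ → Eucl n) {t : ℕ} (ht : 1 ≤ t) :
    pivot X R β η f z (t + 1) = prox X R β t (pivot X R β η f z t)
      (gradEst R β t (f t) (pivot X R β η f z t) (z t) (η t)) (η t) := by
  obtain ⟨s, rfl⟩ : ∃ s, t = s + 1 := ⟨t - 1, by omega⟩
  rfl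

theorem pivot_mem (hR : IsSelfConcordantBarrier ν X R) (hX : IsCompact X)
    (hne : (interior X).Nonempty) (z : ℕ → Eucl n) (t : ℕ) :
    pivot X R β η f z t ∈ interior X := by
  match t with
  | 0 => exact hR.argmin_mem hX hne
  | 1 => exact hR.argmin_mem hX hne
  | t + 2 => exact hR.prox_mem hX hne _ _ _ _ _

/-- The pivot of round t uses only earlier directions, so it is independent of the direction of
round t. -/
theorem pivot_congr {z z' : ℕ → Eucl n} {t : ℕ} (h : ∀ s < t, z s = z' s) :
    pivot X R β η f z t = pivot X R β η f z' t := by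
  induction t with
  | zero => rfl
  | succ t ih =>
    rcases Nat.eq_zero_or_pos t with rfl | ht
    · rfl
    · rw [pivot_succ z ht, pivot_succ z' ht, ih fun s hs => h s (hs.trans t.lt_succ_self),
        h t t.lt_succ_self]

theorem continuous_pivot (hR : IsSelfConcordantBarrier ν X R) (hX : IsCompact X)
    (hne : (interior X).Nonempty) (hc : ∀ t : ℕ, 0 < η t * β * ((t : ℝ) + 1))
    (hf : ∀ t ∈ Finset.Icc 1 T, IsReward X β L ℓ (f t)) {t : ℕ} (ht : t ≤ T) :
    Continuous fun z : ℕ → Metric.sphere (0 : Eucl n) 1 =>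
      pivot X R β η f (fun s => (z s : Eucl n)) t := by
  induction t with
  | zero => exact continuous_const
  | succ t ih =>
    rcases Nat.eq_zero_or_pos t with rfl | ht'
    · exact continuous_const
    · simp only [pivot_succ _ ht']
      have ih' := ih (by omega)
      have hzc : Continuous fun z : ℕ → Metric.sphere (0 : Eucl n) 1 => (z t : Eucl n) := by
        fun_prop
      exact hR.continuous_prox hX hne (hc t) ih' (fun z => pivot_mem hR hX hne _ t)
        (hR.continuous_gradEst (hc t) ih' (fun z => pivot_mem hR hX hne _ t) hzc
          (fun z => by simp)
          ((hf t (Finset.mem_Icc.2 ⟨ht', by omega⟩)).continuousOn.mono interior_subset))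

/-- Subtracting eβ/2‖p - x^t‖² lowers the weight eβ(t+1)/2 to eβt/2, exactly what round t - 1 left
behind, so the sum telescopes. -/
theorem sum_mirror_le (hR : IsSelfConcordantBarrier ν X R) (hX : IsCompact X)
    (hne : (interior X).Nonempty) (hL : 0 ≤ L) (he : 0 < e) (hη : ∀ t, η t = e) (hβ : 0 < β)
    (hf : ∀ t ∈ Finset.Icc 1 T, IsReward X β L ℓ (f t)) (hb : e * (n * L) ≤ 1 / 2)
    {z : ℕ → Eucl n} (hz : ∀ t, ‖z t‖ ≤ 1) (p : Eucl n) {m : ℕ} (hm : m ≤ T) :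
    ∑ t ∈ Finset.Icc 1 m, (e * inner ℝ (gradEst R β t (f t) (pivot X R β η f z t) (z t) (η t))
        (p - pivot X R β η f z t) - e * (β / 2 * ‖p - pivot X R β η f z t‖ ^ 2)) ≤
      e * β / 2 * ‖p - pivot X R β η f z 1‖ ^ 2 + bregman R p (pivot X R β η f z 1) -
      bregman R p (pivot X R β η f z (m + 1)) -
      e * β * ((m : ℝ) + 1) / 2 * ‖p - pivot X R β η f z (m + 1)‖ ^ 2 +
      m * (2 * (e * (n * L)) ^ 2) := by
  induction m with
  | zero => simp
  | succ m ih =>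
    have ih' := ih (by omega)
    rw [Finset.sum_Icc_succ_top (by omega)]
    have h1 := mirror_step_le (p := p) hL (hη (m + 1) ▸ he.le) hR hX
      (by rw [hη]; positivity : 0 < η (m + 1) * β * (((m + 1 : ℕ) : ℝ) + 1))
      (hf (m + 1) (Finset.mem_Icc.2 ⟨by omega, hm⟩))
      (pivot_mem (β := β) (η := η) (f := f) hR hX hne z (m + 1)) (hz (m + 1)) (hη (m + 1) ▸ hb)
    rw [← pivot_succ z (by omega : 1 ≤ m + 1)] at h1
    rw [hη (m + 1)] at h1 ⊢
    push_cast at h1 ⊢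
    nlinarith

end Pivot

/-! ### Independence of the pivots and the directions -/

theorem integrable_of_continuous_compact {Ω Z : Type*} [MeasurableSpace Ω] {P : Measure Ω}
    [IsFiniteMeasure P] [TopologicalSpace Z] [CompactSpace Z] [MeasurableSpace Z] [BorelSpace Z]
    {F : Z → ℝ} (hF : Continuous F) {ζ : Ω → Z} (hζ : Measurable ζ) :
    Integrable (fun ω => F (ζ ω)) P := by
  have h : Integrable F (P.map ζ) :=
    hF.integrable_of_hasCompactSupport (HasCompactSupport.of_compactSpace F)
  exact h.comp_measurable hζ

/-- Conditioning on the directions before round `t`. -/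
theorem integral_le_of_forall_le_integral {S Ω : Type*} [TopologicalSpace S] [CompactSpace S]
    [SecondCountableTopology S] [MeasurableSpace S] [BorelSpace S] [Nonempty S]
    [MeasurableSpace Ω] {P : Measure Ω} [IsProbabilityMeasure P] {z : ℕ → Ω → S}
    (hz : ∀ t, Measurable (z t)) (hind : iIndepFun z P) {σ : Measure S} [IsFiniteMeasure σ]
    {t : ℕ} (hσ : P.map (z t) = σ) {F : (ℕ → S) → S → ℝ} (hF : Continuous (Function.uncurry F))
    (hFt : ∀ y y', (∀ s < t, y s = y' s) → F y = F y') {g : (ℕ → S) → ℝ} (hg : Continuous g)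
    (hgt : ∀ y y', (∀ s < t, y s = y' s) → g y = g y') (hle : ∀ y, g y ≤ ∫ s, F y s ∂σ) :
    ∫ ω, g (fun s => z s ω) ∂P ≤ ∫ ω, F (fun s => z s ω) (z t ω) ∂P := by
  classical
  -- The finite past is padded with an arbitrary point to a full sequence; `F` and `g` do not see
  -- the padding, so they become functions on a finite product.
  let s₀ : S := Classical.arbitrary S
  let ext : (Finset.range t → S) → ℕ → S := fun y s =>
    if h : s ∈ Finset.range t then y ⟨s, h⟩ else s₀
  have hext : Continuous ext := by
    refine continuous_pi fun s => ?_
    by_cases h : s ∈ Finset.range t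
    · simpa only [ext, dif_pos h] using continuous_apply _
    · simpa only [ext, dif_neg h] using continuous_const
  let past : Ω → Finset.range t → S := fun ω i => z i ω
  have hpast : Measurable past := measurable_pi_lambda _ fun i => hz i
  have hagree : ∀ ω, ∀ s < t, z s ω = ext (past ω) s := fun ω s hs => by
    simp [ext, past, hs]
  have hindep : IndepFun past (z t) P := by
    have h1 := hind.indepFun_finset (Finset.range t) {t} (by simp) hz
    exact h1.comp (ψ := fun y : ({t} : Finset ℕ) → S => y ⟨t, by simp⟩) measurable_id
      (measurable_pi_apply _)
  have hmap : P.map (fun ω => (past ω, z t ω)) = (P.map past).prod σ := by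
    rw [← hσ]
    exact (indepFun_iff_map_prod_eq_prod_map_map hpast.aemeasurable (hz t).aemeasurable).1 hindep
  have hFc : Continuous fun q : (Finset.range t → S) × S => F (ext q.1) q.2 :=
    hF.comp ((hext.comp continuous_fst).prodMk continuous_snd)
  have hgc : Continuous fun y => g (ext y) := hg.comp hext
  have : IsProbabilityMeasure (P.map past) := Measure.isProbabilityMeasure_map hpast.aemeasurable
  have hFint : Integrable (fun q : (Finset.range t → S) × S => F (ext q.1) q.2)
      ((P.map past).prod σ) :=
    hFc.integrable_of_hasCompactSupport (HasCompactSupport.of_compactSpace _)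
  calc ∫ ω, g (fun s => z s ω) ∂P = ∫ ω, g (ext (past ω)) ∂P := by
        refine integral_congr_ae (Eventually.of_forall fun ω => hgt _ _ (hagree ω))
    _ = ∫ y, g (ext y) ∂(P.map past) :=
        (integral_map hpast.aemeasurable hgc.aestronglyMeasurable).symm
    _ ≤ ∫ y, ∫ s, F (ext y) s ∂σ ∂(P.map past) :=
        integral_mono (hgc.integrable_of_hasCompactSupport (HasCompactSupport.of_compactSpace _))
          hFint.integral_prod_left fun y => hle (ext y)
    _ = ∫ q, F (ext q.1) q.2 ∂((P.map past).prod σ) := (integral_prod _ hFint).symm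
    _ = ∫ ω, F (ext (past ω)) (z t ω) ∂P := by
        rw [← hmap, integral_map (hpast.prodMk (hz t)).aemeasurable hFc.aestronglyMeasurable]
    _ = ∫ ω, F (fun s => z s ω) (z t ω) ∂P := by
        refine integral_congr_ae (Eventually.of_forall fun ω => ?_)
        simp only
        rw [hFt _ _ (hagree ω)]

end

section

/-! ### Regret -/

section Regret

variable {n : ℕ} {ν : ℝ} {X : Set (Eucl n)} {R : Eucl n → ℝ}
  {β L e : ℝ} {ℓ : ℝ≥0} {T : ℕ} {η : ℕ → ℝ} {f : ℕ → Eucl n → ℝ}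
  {Ω : Type*} [MeasurableSpace Ω] {P : Measure Ω} [IsProbabilityMeasure P]
  {z : ℕ → Ω → Metric.sphere (0 : Eucl n) 1}

theorem continuous_reward_pivot (hR : IsSelfConcordantBarrier ν X R) (hX : IsCompact X)
    (hne : (interior X).Nonempty) (hc : ∀ t : ℕ, 0 < η t * β * ((t : ℝ) + 1))
    (hf : ∀ t ∈ Finset.Icc 1 T, IsReward X β L ℓ (f t)) {t : ℕ} (ht : t ∈ Finset.Icc 1 T) :
    Continuous fun z : ℕ → Metric.sphere (0 : Eucl n) 1 =>
      f t (pivot X R β η f (fun s => (z s : Eucl n)) t) :=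
  (hf t ht).continuousOn.comp_continuous (continuous_pivot hR hX hne hc hf (Finset.mem_Icc.1 ht).2)
    fun _ => interior_subset (pivot_mem hR hX hne _ t)

/-- The past and the current direction are separate arguments, as conditioning requires; the action
itself is the case where the second is the t-th entry of the first. -/
theorem continuous_reward_action (hR : IsSelfConcordantBarrier ν X R) (hX : IsCompact X)
    (hne : (interior X).Nonempty) (hc : ∀ t : ℕ, 0 < η t * β * ((t : ℝ) + 1))
    (hf : ∀ t ∈ Finset.Icc 1 T, IsReward X β L ℓ (f t)) {t : ℕ} (ht : t ∈ Finset.Icc 1 T) :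
    Continuous fun q : (ℕ → Metric.sphere (0 : Eucl n) 1) × Metric.sphere (0 : Eucl n) 1 =>
      f t (play R β t (pivot X R β η f (fun s => (q.1 s : Eucl n)) t) (q.2 : Eucl n) (η t)) := by
  have hp := (continuous_pivot hR hX hne hc hf (Finset.mem_Icc.1 ht).2).comp
    (continuous_fst (Y := Metric.sphere (0 : Eucl n) 1))
  have hz : Continuous fun q : (ℕ → Metric.sphere (0 : Eucl n) 1) ×
      Metric.sphere (0 : Eucl n) 1 => (q.2 : Eucl n) := by fun_prop
  exact (hf t ht).continuousOn.comp_continuous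
    (hR.continuous_play (hc t) hp (fun q => pivot_mem hR hX hne _ t) hz)
    fun q => interior_subset (hR.play_mem_interior (hc t) (pivot_mem hR hX hne _ t) (by simp))

theorem le_integral_inner_gradEst_pivot (hn : 1 ≤ n) (hR : IsSelfConcordantBarrier ν X R)
    (hX : IsCompact X) (hne : (interior X).Nonempty) (hβ : 0 ≤ β)
    (hc : ∀ t : ℕ, 0 < η t * β * ((t : ℝ) + 1))
    (hf : ∀ t ∈ Finset.Icc 1 T, IsReward X β L ℓ (f t)) (hz : ∀ t, Measurable (z t))
    (hind : iIndepFun z P) (hσ : ∀ t, P.map (z t) = sphereUniform n) {p : Eucl n} (hp : p ∈ X)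
    {t : ℕ} (ht : t ∈ Finset.Icc 1 T) :
    ∫ ω, (f t p - f t (pivot X R β η f (fun s => (z s ω : Eucl n)) t) -
        ℓ / (η t * β * ((t : ℝ) + 1))) ∂P ≤
      ∫ ω, (inner ℝ (gradEst R β t (f t) (pivot X R β η f (fun s => (z s ω : Eucl n)) t)
          (z t ω) (η t)) (p - pivot X R β η f (fun s => (z s ω : Eucl n)) t) -
        β / 2 * ‖p - pivot X R β η f (fun s => (z s ω : Eucl n)) t‖ ^ 2) ∂P := by
  have := isProbabilityMeasure_sphereUniform hn
  have hpc := continuous_pivot hR hX hne hc hf (Finset.mem_Icc.1 ht).2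
  have hpq := hpc.comp (continuous_fst (Y := Metric.sphere (0 : Eucl n) 1))
  have hzq : Continuous fun q : (ℕ → Metric.sphere (0 : Eucl n) 1) ×
      Metric.sphere (0 : Eucl n) 1 => (q.2 : Eucl n) := by fun_prop
  have hg := hR.continuous_gradEst (hc t) hpq (fun q => pivot_mem hR hX hne _ t) hzq
    (fun q => by simp) ((hf t ht).continuousOn.mono interior_subset)
  have : Nonempty (Metric.sphere (0 : Eucl n) 1) :=
    (sphereUniform n).nonempty_of_neZero
  refine integral_le_of_forall_le_integral (S := Metric.sphere (0 : Eucl n) 1) (t := t)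
    (F := fun y s => inner ℝ (gradEst R β t (f t) (pivot X R β η f (fun s => (y s : Eucl n)) t)
          s (η t)) (p - pivot X R β η f (fun s => (y s : Eucl n)) t) -
        β / 2 * ‖p - pivot X R β η f (fun s => (y s : Eucl n)) t‖ ^ 2)
    (g := fun y => f t p - f t (pivot X R β η f (fun s => (y s : Eucl n)) t) -
        ℓ / (η t * β * ((t : ℝ) + 1))) hz hind (hσ t) ?_ ?_ ?_ ?_ ?_
  · exact (hg.inner (continuous_const.sub hpq)).sub
      (continuous_const.mul ((continuous_const.sub hpq).norm.pow 2))
  · intro y y' h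
    funext s
    rw [pivot_congr (z := fun s => (y s : Eucl n)) (z' := fun s => (y' s : Eucl n))
      fun s hs => by rw [h s hs]]
  · exact (continuous_const.sub (continuous_reward_pivot hR hX hne hc hf ht)).sub continuous_const
  · intro y y' h
    rw [pivot_congr (z := fun s => (y s : Eucl n)) (z' := fun s => (y' s : Eucl n))
      fun s hs => by rw [h s hs]]
  · intro y
    have hx := pivot_mem (β := β) (η := η) (f := f) hR hX hne (fun s => (y s : Eucl n)) t
    have h1 := le_integral_inner_gradEst hn hR hβ (hc t) (hf t ht) hx hp
    have hcs : Continuous fun s : Metric.sphere (0 : Eucl n) 1 =>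
        inner ℝ (gradEst R β t (f t) (pivot X R β η f (fun s => (y s : Eucl n)) t)
          s (η t)) (p - pivot X R β η f (fun s => (y s : Eucl n)) t) :=
      (hR.continuous_gradEst (hc t) continuous_const (fun _ => hx) continuous_subtype_val
        (fun s => by simp) ((hf t ht).continuousOn.mono interior_subset)).inner continuous_const
    rw [integral_sub (integrable_sphere hcs _) (integrable_const _), integral_const, probReal_univ,
      one_smul]
    linarith

theorem le_integral_reward_action (hn : 1 ≤ n) (hR : IsSelfConcordantBarrier ν X R)
    (hX : IsCompact X) (hne : (interior X).Nonempty) (hβ : 0 ≤ β)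
    (hc : ∀ t : ℕ, 0 < η t * β * ((t : ℝ) + 1))
    (hf : ∀ t ∈ Finset.Icc 1 T, IsReward X β L ℓ (f t)) (hz : ∀ t, Measurable (z t))
    (hind : iIndepFun z P) (hσ : ∀ t, P.map (z t) = sphereUniform n)
    {t : ℕ} (ht : t ∈ Finset.Icc 1 T) :
    ∫ ω, (f t (pivot X R β η f (fun s => (z s ω : Eucl n)) t) -
        ℓ / (η t * β * ((t : ℝ) + 1))) ∂P ≤
      ∫ ω, f t (action X R β η f (fun s => (z s ω : Eucl n)) t) ∂P := by
  have := isProbabilityMeasure_sphereUniform hn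
  have : Nonempty (Metric.sphere (0 : Eucl n) 1) :=
    (sphereUniform n).nonempty_of_neZero
  refine integral_le_of_forall_le_integral (S := Metric.sphere (0 : Eucl n) 1) (t := t)
    (F := fun y s =>
      f t (play R β t (pivot X R β η f (fun s => (y s : Eucl n)) t) (s : Eucl n) (η t)))
    (g := fun y => f t (pivot X R β η f (fun s => (y s : Eucl n)) t) -
        ℓ / (η t * β * ((t : ℝ) + 1))) hz hind (hσ t)
    (continuous_reward_action hR hX hne hc hf ht) ?_
    ((continuous_reward_pivot hR hX hne hc hf ht).sub continuous_const) ?_ ?_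
  · intro y y' h
    funext s
    rw [pivot_congr (z := fun s => (y s : Eucl n)) (z' := fun s => (y' s : Eucl n))
      fun s hs => by rw [h s hs]]
  · intro y y' h
    rw [pivot_congr (z := fun s => (y s : Eucl n)) (z' := fun s => (y' s : Eucl n))
      fun s hs => by rw [h s hs]]
  · intro y
    exact le_integral_play hn hR hβ (hc t) (hf t ht) (pivot_mem hR hX hne _ t)

theorem integrable_reward_pivot (hR : IsSelfConcordantBarrier ν X R) (hX : IsCompact X)
    (hne : (interior X).Nonempty) (hc : ∀ t : ℕ, 0 < η t * β * ((t : ℝ) + 1))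
    (hf : ∀ t ∈ Finset.Icc 1 T, IsReward X β L ℓ (f t)) (hz : ∀ t, Measurable (z t))
    {t : ℕ} (ht : t ∈ Finset.Icc 1 T) :
    Integrable (fun ω => f t (pivot X R β η f (fun s => (z s ω : Eucl n)) t)) P :=
  integrable_of_continuous_compact (continuous_reward_pivot hR hX hne hc hf ht)
    (ζ := fun ω s => z s ω) (measurable_pi_lambda _ hz)

theorem integrable_reward_action (hR : IsSelfConcordantBarrier ν X R) (hX : IsCompact X)
    (hne : (interior X).Nonempty) (hc : ∀ t : ℕ, 0 < η t * β * ((t : ℝ) + 1))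
    (hf : ∀ t ∈ Finset.Icc 1 T, IsReward X β L ℓ (f t)) (hz : ∀ t, Measurable (z t))
    {t : ℕ} (ht : t ∈ Finset.Icc 1 T) :
    Integrable (fun ω => f t (action X R β η f (fun s => (z s ω : Eucl n)) t)) P :=
  integrable_of_continuous_compact (continuous_reward_action hR hX hne hc hf ht)
    (ζ := fun ω => (fun s => z s ω, z t ω)) ((measurable_pi_lambda _ hz).prodMk (hz t))

/-- For interior p the final divergence is nonnegative and can be dropped, and the initial one
equals R(p) - R(x₁) because the gradient vanishes at the minimizer. -/
theorem interior_regret_le (hn : 1 ≤ n) (hR : IsSelfConcordantBarrier ν X R)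
    (hX : IsCompact X) (hne : (interior X).Nonempty) (hL : 0 ≤ L) (hβ : 0 < β) (he : 0 < e)
    (hη : ∀ t, η t = e) (hT : 1 ≤ T) (hb : e * (n * L) ≤ 1 / 2)
    (hbT : T * (2 * (e * (n * L)) ^ 2) ≤ 1 / 2)
    (hf : ∀ t ∈ Finset.Icc 1 T, IsReward X β L ℓ (f t)) (hz : ∀ t, Measurable (z t))
    (hind : iIndepFun z P) (hσ : ∀ t, P.map (z t) = sphereUniform n) {p : Eucl n}
    (hp : p ∈ interior X) :
    ∑ t ∈ Finset.Icc 1 T, (f t p -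
        ∫ ω, f t (pivot X R β η f (fun s => (z s ω : Eucl n)) t) ∂P) ≤
      8 * L + (R p - R (argmin (interior X) R) + 1 / 2) / e +
        ∑ t ∈ Finset.Icc 1 T, ℓ / (e * β * ((t : ℝ) + 1)) := by
  have hc : ∀ t : ℕ, 0 < η t * β * ((t : ℝ) + 1) := fun t => by rw [hη]; positivity
  set x₁ := argmin (interior X) R with hx₁
  set W : ℕ → Ω → ℝ := fun t ω =>
    inner ℝ (gradEst R β t (f t) (pivot X R β η f (fun s => (z s ω : Eucl n)) t)
      (z t ω) (η t)) (p - pivot X R β η f (fun s => (z s ω : Eucl n)) t) -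
      β / 2 * ‖p - pivot X R β η f (fun s => (z s ω : Eucl n)) t‖ ^ 2 with hW
  have hWint : ∀ t ∈ Finset.Icc 1 T, Integrable (W t) P := by
    intro t ht
    have hpc := continuous_pivot hR hX hne hc hf (Finset.mem_Icc.1 ht).2
    have hzc : Continuous fun y : ℕ → Metric.sphere (0 : Eucl n) 1 => (y t : Eucl n) := by
      fun_prop
    have hg := hR.continuous_gradEst (hc t) hpc (fun q => pivot_mem hR hX hne _ t) hzc
      (fun q => by simp) ((hf t ht).continuousOn.mono interior_subset)
    exact integrable_of_continuous_compact (F := fun y : ℕ → Metric.sphere (0 : Eucl n) 1 =>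
      inner ℝ (gradEst R β t (f t) (pivot X R β η f (fun s => (y s : Eucl n)) t)
        (y t) (η t)) (p - pivot X R β η f (fun s => (y s : Eucl n)) t) -
        β / 2 * ‖p - pivot X R β η f (fun s => (y s : Eucl n)) t‖ ^ 2)
      ((hg.inner (continuous_const.sub hpc)).sub
        (continuous_const.mul ((continuous_const.sub hpc).norm.pow 2)))
      (ζ := fun ω s => z s ω) (measurable_pi_lambda _ hz)
  have hpath : ∀ ω, ∑ t ∈ Finset.Icc 1 T, W t ω ≤ 8 * L + (R p - R x₁ + 1 / 2) / e := by
    intro ω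
    have h1 := sum_mirror_le hR hX hne hL he hη hβ hf hb (z := fun s => (z s ω : Eucl n))
      (fun t => by simp) p (le_refl T)
    have h2 := hR.bregman_nonneg
      (pivot_mem (β := β) (η := η) (f := f) hR hX hne (fun s => (z s ω : Eucl n)) (T + 1)) hp
    have h3 : pivot X R β η f (fun s => (z s ω : Eucl n)) 1 = x₁ := rfl
    rw [h3] at h1
    have h4 : bregman R p x₁ = R p - R x₁ := by
      rw [bregman, hx₁, hR.gradient_argmin hX hne, inner_zero_left, sub_zero]
    have h5 := (hf 1 (Finset.mem_Icc.2 ⟨le_rfl, hT⟩)).norm_sub_sq_le hβ (interior_subset hp)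
      (interior_subset (hR.argmin_mem hX hne))
    rw [← hx₁] at h5
    -- The squared diameter is at most 16L/β, whence the constant 8L.
    have h6 : e * β / 2 * ‖p - x₁‖ ^ 2 ≤ e * (8 * L) := by
      rw [le_div_iff₀ hβ] at h5
      nlinarith
    have h7 : 0 ≤ e * β * ((T : ℝ) + 1) / 2 *
      ‖p - pivot X R β η f (fun s => (z s ω : Eucl n)) (T + 1)‖ ^ 2 := by positivity
    simp only [← mul_sub, ← Finset.mul_sum] at h1
    have h8 : e * ∑ t ∈ Finset.Icc 1 T, W t ω ≤ e * (8 * L) + (R p - R x₁ + 1 / 2) := by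
      simp only [hW]
      linarith
    have h9 : e * (8 * L) + (R p - R x₁ + 1 / 2) = e * (8 * L + (R p - R x₁ + 1 / 2) / e) := by
      field_simp
    rw [h9] at h8
    exact le_of_mul_le_mul_left h8 he
  have hEW : ∑ t ∈ Finset.Icc 1 T, ∫ ω, W t ω ∂P ≤ 8 * L + (R p - R x₁ + 1 / 2) / e := by
    rw [← integral_finsetSum _ hWint]
    have := integral_mono (μ := P) (integrable_finsetSum _ hWint) (integrable_const _) hpath
    simpa using this
  have hround : ∀ t ∈ Finset.Icc 1 T, f t p -
      ∫ ω, f t (pivot X R β η f (fun s => (z s ω : Eucl n)) t) ∂P ≤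
      ∫ ω, W t ω ∂P + ℓ / (e * β * ((t : ℝ) + 1)) := by
    intro t ht
    have h1 := le_integral_inner_gradEst_pivot hn hR hX hne hβ.le hc hf hz hind hσ
      (interior_subset hp) ht
    have hi := integrable_reward_pivot (P := P) hR hX hne hc hf hz ht
    have hi' : Integrable (fun ω =>
        f t p - f t (pivot X R β η f (fun s => (z s ω : Eucl n)) t)) P := (integrable_const _).sub hi
    rw [integral_sub hi' (integrable_const _), integral_sub (integrable_const _) hi,
      integral_const, integral_const, probReal_univ, one_smul, one_smul, hη t] at h1
    simp only [hW, hη t]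
    linarith
  refine (Finset.sum_le_sum hround).trans ?_
  rw [Finset.sum_add_distrib]
  linarith

theorem regret_le (hn : 1 ≤ n) (hR : IsSelfConcordantBarrier ν X R) (hν : 0 ≤ ν)
    (hX : IsCompact X) (hXc : Convex ℝ X) (hne : (interior X).Nonempty) (hL : 0 ≤ L) (hβ : 0 < β)
    (he : 0 < e) (hη : ∀ t, η t = e) (hT : 1 ≤ T) (hb : e * (n * L) ≤ 1 / 2)
    (hbT : T * (2 * (e * (n * L)) ^ 2) ≤ 1 / 2)
    (hf : ∀ t ∈ Finset.Icc 1 T, IsReward X β L ℓ (f t)) (hz : ∀ t, Measurable (z t))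
    (hind : iIndepFun z P) (hσ : ∀ t, P.map (z t) = sphereUniform n) {p : Eucl n}
    (hp : p ∈ X) :
    ∑ t ∈ Finset.Icc 1 T, (f t p -
        ∫ ω, f t (pivot X R β η f (fun s => (z s ω : Eucl n)) t) ∂P) ≤
      10 * L + ((ν + 1) * Real.log T + 1 / 2) / e +
        ∑ t ∈ Finset.Icc 1 T, ℓ / (e * β * ((t : ℝ) + 1)) := by
  have hT' : (1 : ℝ) ≤ T := by exact_mod_cast hT
  have hT0 : (0 : ℝ) < T := by linarith
  set x₁ := argmin (interior X) R with hx₁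
  have hx₁m : x₁ ∈ interior X := hR.argmin_mem hX hne
  -- By concavity, pulling p back by 1/T loses at most 2L/T per round, while the barrier term
  -- becomes log(1/(1 - s)) = log T.
  set s : ℝ := 1 - 1 / T with hs
  have hs1 : s < 1 := sub_lt_self _ (by positivity)
  have hs0 : 0 ≤ s := sub_nonneg.2 ((div_le_one hT0).2 hT')
  have hp' : x₁ + s • (p - x₁) ∈ interior X := by
    have := hXc.add_smul_sub_mem_interior hp hx₁m (t := 1 - s) ⟨by linarith, by linarith⟩
    convert this using 1
    module
  have h1 := interior_regret_le hn hR hX hne hL hβ he hη hT hb hbT hf hz hind hσ hp'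
  have h2 := hR.sub_le_log hν hXc hx₁m hp ⟨hs0, hs1⟩
  have e1 : 1 / (1 - s) = T := by rw [hs]; field_simp; ring
  rw [e1] at h2
  have h3 : ∑ t ∈ Finset.Icc 1 T, f t p ≤ ∑ t ∈ Finset.Icc 1 T, f t (x₁ + s • (p - x₁)) + 2 * L := by
    have : ∀ t ∈ Finset.Icc 1 T, f t p ≤ f t (x₁ + s • (p - x₁)) + 2 * L / T := by
      intro t ht
      have hcon := ((hf t ht).strongConcaveOn.2 hp (interior_subset hx₁m) hs0
        (by linarith : 0 ≤ 1 - s) (by ring))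
      have e2 : s • p + (1 - s) • x₁ = x₁ + s • (p - x₁) := by module
      rw [e2] at hcon
      simp only [smul_eq_mul] at hcon
      have h4 := abs_le.1 ((hf t ht).bounded p hp)
      have h5 := abs_le.1 ((hf t ht).bounded x₁ (interior_subset hx₁m))
      have h6 : 0 ≤ s * (1 - s) * (β / 2 * ‖p - x₁‖ ^ 2) :=
        mul_nonneg (mul_nonneg hs0 (by linarith)) (by positivity)
      have h7 : (1 - s) * (f t p - f t x₁) ≤ (1 - s) * (2 * L) :=
        mul_le_mul_of_nonneg_left (by linarith [h4.2, h5.1]) (by linarith)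
      have h8 : 2 * L / T = (1 - s) * (2 * L) := by rw [hs]; ring
      rw [h8]
      nlinarith
    refine (Finset.sum_le_sum this).trans ?_
    rw [Finset.sum_add_distrib, Finset.sum_const, Nat.card_Icc, nsmul_eq_mul, Nat.add_sub_cancel]
    have : (T : ℝ) * (2 * L / T) = 2 * L := by field_simp
    linarith
  have h4 : (R (x₁ + s • (p - x₁)) - R x₁ + 1 / 2) / e ≤
      ((ν + 1) * Real.log T + 1 / 2) / e := by gcongr
  rw [Finset.sum_sub_distrib] at h1 ⊢
  rw [← hx₁] at h1
  linarith

theorem sum_div_le_log {e : ℝ} (he : 0 < e) (hβ : 0 < β) (T : ℕ) :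
    ∑ t ∈ Finset.Icc 1 T, ℓ / (e * β * ((t : ℝ) + 1)) ≤ ℓ / (e * β) * (1 + Real.log T) := by
  have h1 := harmonic_le_one_add_log T
  rw [harmonic_eq_sum_Icc] at h1
  push_cast at h1
  calc ∑ t ∈ Finset.Icc 1 T, ℓ / (e * β * ((t : ℝ) + 1))
      ≤ ∑ t ∈ Finset.Icc 1 T, ℓ / (e * β) * (t : ℝ)⁻¹ := by
        refine Finset.sum_le_sum fun t ht => ?_
        have ht' : (0 : ℝ) < t := by
          have := (Finset.mem_Icc.1 ht).1
          positivity
        rw [← div_div, div_eq_mul_inv (ℓ / (e * β) : ℝ)]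
        gcongr
        linarith
    _ = ℓ / (e * β) * ∑ t ∈ Finset.Icc 1 T, (t : ℝ)⁻¹ := by rw [Finset.mul_sum]
    _ ≤ _ := by gcongr

theorem exists_isRegret {Ω : Type*} [MeasurableSpace Ω] {P : Measure Ω} (hX : IsCompact X) (hne : X.Nonempty)
    (hf : ∀ t ∈ Finset.Icc 1 T, ContinuousOn (f t) X) {y : ℕ → Ω → Eucl n}
    (hy : ∀ t ∈ Finset.Icc 1 T, Integrable (fun ω => f t (y t ω)) P) {B : ℝ}
    (hB : ∀ p ∈ X, ∑ t ∈ Finset.Icc 1 T, (f t p - ∫ ω, f t (y t ω) ∂P) ≤ B) :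
    ∃ r, IsRegret P X T f y r ∧ r ≤ B := by
  have hcont : ContinuousOn (fun p => ∑ t ∈ Finset.Icc 1 T, f t p
      - ∫ ω, ∑ t ∈ Finset.Icc 1 T, f t (y t ω) ∂P) X :=
    (continuousOn_finsetSum _ hf).sub continuousOn_const
  obtain ⟨p, hp, hmax⟩ := hX.exists_isMaxOn hne hcont
  refine ⟨_, ⟨mem_image_of_mem _ hp, ?_⟩, ?_⟩
  · rintro _ ⟨q, hq, rfl⟩
    exact hmax hq
  · have := hB p hp
    rwa [Finset.sum_sub_distrib, ← integral_finsetSum _ hy] at this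

end Regret

/-- The last sum is doubled to serve the played points as well: one copy pays for the bias of the
estimator, the other for exploration. -/
theorem total_le {n : ℕ} {ν β L e : ℝ} {ℓ : ℝ≥0} {T : ℕ} (hν : 0 ≤ ν) (hL : 0 < L) (hT : 1 ≤ T)
    (he : 1 / e = 2 * n * L * √T) :
    10 * L + ((ν + 1) * Real.log T + 1 / 2) / e + 2 * (ℓ / (e * β) * (1 + Real.log T)) ≤
      (10 * L + 2 * n * L * (ν + 2) + 4 * n * L * ℓ / β) * √T * (1 + Real.log T) := by
  have hT' : (1 : ℝ) ≤ T := by exact_mod_cast hT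
  have hlog : 0 ≤ Real.log T := Real.log_nonneg hT'
  have hsq : 1 ≤ √(T : ℝ) := Real.one_le_sqrt.2 hT'
  have e1 : ((ν + 1) * Real.log T + 1 / 2) / e =
      ((ν + 1) * Real.log T + 1 / 2) * (2 * n * L * √T) := by rw [← he]; ring
  have e2 : 2 * (ℓ / (e * β) * (1 + Real.log T)) =
      4 * n * L * ℓ / β * √T * (1 + Real.log T) := by
    have : (ℓ / (e * β) : ℝ) = ℓ / β * (1 / e) := by ring
    rw [this, he]; ring
  have h1 : (1 : ℝ) ≤ √T * (1 + Real.log T) := by nlinarith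
  have h2 : (ν + 1) * Real.log T + 1 / 2 ≤ (ν + 2) * (1 + Real.log T) := by nlinarith
  have h3 : ((ν + 1) * Real.log T + 1 / 2) * (2 * n * L * √T) ≤
      (ν + 2) * (1 + Real.log T) * (2 * n * L * √T) := by gcongr
  rw [e1, e2]
  nlinarith

end

end EagerBandit

end

open EagerBandit in
theorem mainTheorem1 (n : ℕ) (hn : 1 ≤ n) (ν β L : ℝ) (ℓ : ℝ≥0)
    (hν : 0 ≤ ν) (hβ : 0 < β) (hL : 0 < L) :
    ∃ C : ℝ, ∀ (X : Set (Eucl n)) (R : Eucl n → ℝ),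
      IsClosed X → Convex ℝ X → (interior X).Nonempty →
      IsSelfConcordantBarrier ν X R →
      ∀ (T : ℕ), 1 ≤ T → ∀ (η : ℕ → ℝ), (∀ t, η t = 1 / (2 * n * L * √T)) →
      ∀ (f : ℕ → Eucl n → ℝ), (∀ t ∈ Finset.Icc 1 T, IsReward X β L ℓ (f t)) →
      ∀ (Ω : Type*) [MeasurableSpace Ω] (P : Measure Ω) [IsProbabilityMeasure P]
        (z : ℕ → Ω → Metric.sphere (0 : Eucl n) 1),
        (∀ t, Measurable (z t)) → iIndepFun z P → (∀ t, P.map (z t) = sphereUniform n) →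
      ∀ (x xhat : ℕ → Ω → Eucl n),
        (∀ t ω, x t ω = pivot X R β η f (fun s => (z s ω : Eucl n)) t) →
        (∀ t ω, xhat t ω = action X R β η f (fun s => (z s ω : Eucl n)) t) →
      (∀ t ∈ Finset.Icc 1 T, (∀ ω, x t ω ∈ interior X ∧ xhat t ω ∈ X) ∧
        Integrable (fun ω => f t (x t ω)) P ∧ Integrable (fun ω => f t (xhat t ω)) P) ∧
      (∃ r, IsRegret P X T f xhat r ∧ r ≤ C * √T * (1 + Real.log T)) ∧
      (∃ r, IsRegret P X T f x r ∧ r ≤ C * √T * (1 + Real.log T)) := by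
  refine ⟨10 * L + 2 * n * L * (ν + 2) + 4 * n * L * ℓ / β, ?_⟩
  intro X R hXcl hXc hne hR T hT η hη f hf Ω _ P _ z hz hind hσ x xhat hx hxhat
  obtain rfl : x = fun t ω => pivot X R β η f (fun s => (z s ω : Eucl n)) t :=
    funext fun t => funext fun ω => hx t ω
  obtain rfl : xhat = fun t ω => action X R β η f (fun s => (z s ω : Eucl n)) t :=
    funext fun t => funext fun ω => hxhat t ω
  have hX : IsCompact X := (hf 1 (Finset.mem_Icc.2 ⟨le_rfl, hT⟩)).isCompact hβ hXcl
  have hT' : (1 : ℝ) ≤ T := by exact_mod_cast hT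
  have hn' : (0 : ℝ) < n := by exact_mod_cast hn
  have hsq : 1 ≤ √(T : ℝ) := Real.one_le_sqrt.2 hT'
  obtain ⟨e, hedef⟩ : ∃ e : ℝ, e = 1 / (2 * n * L * √T) := ⟨_, rfl⟩
  rw [← hedef] at hη
  have he : 0 < e := by rw [hedef]; positivity
  have he' : 1 / e = 2 * n * L * √T := by rw [hedef, one_div_one_div]
  have hnL : e * (n * L) = 1 / (2 * √T) := by rw [hedef]; field_simp
  have hb : e * (n * L) ≤ 1 / 2 := by
    rw [hnL]
    exact one_div_le_one_div_of_le (by norm_num) (by linarith)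
  -- Since e·nL = 1/(2√T), each round contributes 1/(2T).
  have hbT : T * (2 * (e * (n * L)) ^ 2) ≤ 1 / 2 := by
    rw [hnL, div_pow, mul_pow, Real.sq_sqrt (by linarith)]
    field_simp
    norm_num
  have hc : ∀ t : ℕ, 0 < η t * β * ((t : ℝ) + 1) := fun t => by rw [hη]; positivity
  have hix := fun t ht => integrable_reward_pivot (P := P) (t := t) hR hX hne hc hf hz ht
  have hia := fun t ht => integrable_reward_action (P := P) (t := t) hR hX hne hc hf hz ht
  have hsum := sum_div_le_log (ℓ := ℓ) he hβ T
  have hsum0 : 0 ≤ ∑ t ∈ Finset.Icc 1 T, ℓ / (e * β * ((t : ℝ) + 1)) :=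
    Finset.sum_nonneg fun t _ => by positivity
  have htot := total_le (ℓ := ℓ) (β := β) hν hL hT he'
  have hreg := fun p (hp : p ∈ X) => regret_le hn hR hν hX hXc hne hL.le hβ he hη hT hb hbT hf hz
    hind hσ hp
  refine ⟨fun t ht => ⟨fun ω => ⟨pivot_mem hR hX hne _ t, interior_subset
    (hR.play_mem_interior (hc t) (pivot_mem hR hX hne _ t) (by simp))⟩, hix t ht, hia t ht⟩, ?_, ?_⟩
  · refine exists_isRegret hX (hne.mono interior_subset) (fun t ht => (hf t ht).continuousOn) hia
      fun p hp => ?_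
    -- The played points are compared with the pivots round by round, at the price of the
    -- exploration cost.
    have h1 : ∀ t ∈ Finset.Icc 1 T,
        f t p - ∫ ω, f t (action X R β η f (fun s => (z s ω : Eucl n)) t) ∂P ≤
        (f t p - ∫ ω, f t (pivot X R β η f (fun s => (z s ω : Eucl n)) t) ∂P) +
          ℓ / (e * β * ((t : ℝ) + 1)) := by
      intro t ht
      have h2 := le_integral_reward_action hn hR hX hne hβ.le hc hf hz hind hσ ht
      rw [integral_sub (hix t ht) (integrable_const _), integral_const, probReal_univ, one_smul,
        hη t] at h2
      linarith
    have h3 := Finset.sum_le_sum h1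
    rw [Finset.sum_add_distrib] at h3
    linarith [hreg p hp]
  · refine exists_isRegret hX (hne.mono interior_subset) (fun t ht => (hf t ht).continuousOn) hix
      fun p hp => ?_
    linarith [hreg p hp]
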